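/- Let $0<d<\pi/2$ and $\mathscr{D}_d=\{\zeta\in\mathbb{C}:|\operatorname{Im}\zeta|<d\}$. Put $\psi_2(\zeta)=\mathrm{e}^{\zeta}$ and $\psi_3(\zeta)=\operatorname{arcsinh}(\mathrm{e}^{\zeta})$ (principal branch), and let $\psi_i^{-1}:(0,\infty)\to\mathbb{R}$ be the inverse of the restriction of $\psi_i$ to $\mathbb{R}$. For $\alpha,\beta>0$ let (principal branches) $$E_2(z;\alpha,\beta)=\frac{z^{\alpha-1}}{(1+z^2)^{(\alpha+\beta)/2}},\qquad E_3(z;\alpha,\beta)=\left(\frac{z}{1+z}\right)^{\alpha-1}\mathrm{e}^{-\beta z},$$ and let $$J(k,h)(x)=h\left\{\frac12+\frac1\pi\operatorname{Si}\bigl[\pi(x/h-k)\bigr]\right\},\qquad \operatorname{Si}(x)=\int_0^x\frac{\sin\sigma}{\sigma}\,d\sigma .$$ **Theorem.** The following is true for $i=2$ and $i=3$. Assume that $f$ is analytic in $\psi_i(\mathscr{D}_d)$, and that there are positive constants $K$, $\alpha$, $\beta$ such that $|f(z)|\le K|E_i(z;\alpha,\beta)|$ for all $z\in\psi_i(\mathscr{D}_d)$.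 Let $\mu=\min\{\alpha,\beta\}$, let $n$ be a positive integer, let $h=\sqrt{\pi d/(\mu n)}$, and let $$\begin{cases} M=n,\quad N=\lceil\alpha n/\beta\rceil & (\text{if }\mu=\alpha),\\ N=n,\quad M=\lceil\beta n/\alpha\rceil & (\text{if }\mu=\beta).\end{cases}$$ Then $f$ is integrable on $(0,\tau)$ for every $\tau>0$, and $$\sup_{\tau\in(0,\infty)}\left|\int_0^{\tau}f(t)\,dt-\sum_{k=-M}^{N}f(\psi_i(kh))\,\psi_i'(kh)\,J(k,h)(\psi_i^{-1}(\tau))\right|\le C_i\,\mathrm{e}^{-\sqrt{\pi d\mu n}},$$ where $C_2$ and $C_3$ are the constants, independent of $n$, $$C_2=\frac{2K}{\mu}\left\{\frac{1}{(1-\mathrm{e}^{-2\sqrt{\pi d\mu}})\{\cos d\}^{(\alpha+\beta)/2}}\sqrt{\frac{\pi}{d\mu}}+1.1\right\},$$ $$C_3=\frac{2K}{\mu}\left\{\frac{2^{1+(\beta/2)}c_{\alpha,d}}{(1-\mathrm{e}^{-2\sqrt{\pi d\mu}})\{\cos d\}^{(\alpha+\beta)/2}}\sqrt{\frac{\pi}{d\mu}}+1.1\cdot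 2^{(1-\alpha+|1-\alpha|)/2}\right\},$$ with $c_{\alpha,d}=\{2(1+1/\cos d)\}^{(1-\alpha)/2}$ if $0<\alpha<1$ and $c_{\alpha,d}=2^{(\alpha-1)/2}$ if $\alpha\ge1$. -/

import Mathlib

open MeasureTheory

noncomputable section

/-- The strip `{ζ ∈ ℂ : |Im ζ| < d}`. -/
def strip (d : ℝ) : Set ℂ := {ζ : ℂ | |ζ.im| < d}

/-- The principal branch of the inverse hyperbolic sine, `log (w + √(1 + w²))`, with the principal
branches of the logarithm and of the square root. -/
def carcsinh (w : ℂ) : ℂ := Complex.log (w + (1 + w ^ 2) ^ (1 / 2 : ℂ))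

/-- The single-exponential map of case 2, `ζ ↦ exp ζ`. -/
def seMap₂ (ζ : ℂ) : ℂ := Complex.exp ζ

/-- The single-exponential map of case 3, `ζ ↦ arcsinh (exp ζ)`. -/
def seMap₃ (ζ : ℂ) : ℂ := carcsinh (Complex.exp ζ)

/-- The inverse `(0, ∞) → ℝ` of `seMap₂` restricted to the real line. -/
def seInv₂ (τ : ℝ) : ℝ := Real.log τ

/-- The inverse `(0, ∞) → ℝ` of `seMap₃` restricted to the real line. -/
def seInv₃ (τ : ℝ) : ℝ := Real.log (Real.sinh τ)

/-- `E₂(z; α, β) = z^(α-1) / (1 + z²)^((α+β)/2)`, principal branches. -/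
def E₂ (z : ℂ) (α β : ℝ) : ℂ :=
  z ^ ((α - 1 : ℝ) : ℂ) / (1 + z ^ 2) ^ (((α + β) / 2 : ℝ) : ℂ)

/-- `E₃(z; α, β) = (z / (1 + z))^(α-1) · exp (-β z)`, principal branch. -/
def E₃ (z : ℂ) (α β : ℝ) : ℂ :=
  (z / (1 + z)) ^ ((α - 1 : ℝ) : ℂ) * Complex.exp (-(β : ℂ) * z)

/-- The sine integral `Si x = ∫₀ˣ (sin σ) / σ dσ`. -/
def sineIntegral (x : ℝ) : ℝ := ∫ σ in (0 : ℝ)..x, Real.sin σ / σ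

/-- The basis function `J(k, h)(x) = h (1/2 + (1/π) Si (π (x/h - k)))`. -/
def sincJ (k : ℤ) (h : ℝ) (x : ℝ) : ℝ :=
  h * (1 / 2 + 1 / Real.pi * sineIntegral (Real.pi * (x / h - k)))

/-- The mesh size `h = √(π d / (μ n))` with `μ = min α β`. -/
def meshSize (d α β : ℝ) (n : ℕ) : ℝ := Real.sqrt (Real.pi * d / (min α β * n))

/-- The lower truncation number: `n` if `μ = α`, and `⌈β n / α⌉` otherwise. -/
def truncM (α β : ℝ) (n : ℕ) : ℕ := if min α β = α then n else ⌈β * n / α⌉₊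

/-- The upper truncation number: `⌈α n / β⌉` if `μ = α`, and `n` otherwise. -/
def truncN (α β : ℝ) (n : ℕ) : ℕ := if min α β = α then ⌈α * n / β⌉₊ else n

/-- The Sinc approximation `∑_{k=-M}^{N} f(ψ(kh)) ψ'(kh) J(k,h)(ξ)` of the indefinite integral of
`f`, for the variable transformation `ψ` (evaluated at the real nodes `kh`). -/
def sincIndef (ψ f : ℂ → ℂ) (d α β : ℝ) (n : ℕ) (ξ : ℝ) : ℂ :=
  ∑ k ∈ Finset.Icc (-(truncM α β n : ℤ)) (truncN α β n : ℤ),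
    f (ψ (((k : ℝ) * meshSize d α β n : ℝ) : ℂ)) *
      deriv ψ (((k : ℝ) * meshSize d α β n : ℝ) : ℂ) *
      (sincJ k (meshSize d α β n) ξ : ℂ)

/-- The constant `c_{α,d}`. -/
def constc (α d : ℝ) : ℝ :=
  if α < 1 then (2 * (1 + 1 / Real.cos d)) ^ ((1 - α) / 2) else 2 ^ ((α - 1) / 2)

/-- The constant `C₂`. -/
def constC₂ (K d α β : ℝ) : ℝ :=
  2 * K / min α β *
    (1 / ((1 - Real.exp (-(2 * Real.sqrt (Real.pi * d * min α β)))) *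
          Real.cos d ^ ((α + β) / 2)) * Real.sqrt (Real.pi / (d * min α β)) + 1.1)

/-- The constant `C₃`. -/
def constC₃ (K d α β : ℝ) : ℝ :=
  2 * K / min α β *
    (2 ^ (1 + β / 2) * constc α d /
        ((1 - Real.exp (-(2 * Real.sqrt (Real.pi * d * min α β)))) *
          Real.cos d ^ ((α + β) / 2)) * Real.sqrt (Real.pi / (d * min α β)) +
      1.1 * 2 ^ ((1 - α + |1 - α|) / 2))

/-- On the real line, `seMap₂` is the real exponential. -/
theorem seMap₂_ofReal (x : ℝ) : seMap₂ x = (Real.exp x : ℂ) := by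
  simp [seMap₂]

/-- On the real line, `carcsinh` is the real inverse hyperbolic sine. -/
theorem carcsinh_ofReal (x : ℝ) : carcsinh x = (Real.arsinh x : ℂ) := by
  have h1 : (0 : ℝ) ≤ 1 + x ^ 2 := by positivity
  have h2 : ((1 : ℂ) + (x : ℂ) ^ 2) ^ (1 / 2 : ℂ) = (Real.sqrt (1 + x ^ 2) : ℂ) := by
    rw [Real.sqrt_eq_rpow, Complex.ofReal_cpow h1]
    push_cast
    rfl
  have h3 : (0 : ℝ) ≤ x + Real.sqrt (1 + x ^ 2) := by
    rw [← Real.exp_arsinh]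
    exact (Real.exp_pos _).le
  rw [carcsinh, h2, Real.arsinh, Complex.ofReal_log h3]
  push_cast
  rfl

/-- On the real line, `seMap₃` is `x ↦ arcsinh (exp x)`. -/
theorem seMap₃_ofReal (x : ℝ) : seMap₃ x = (Real.arsinh (Real.exp x) : ℂ) := by
  rw [seMap₃, ← Complex.ofReal_exp, carcsinh_ofReal]

theorem seMap₂_seInv₂ {τ : ℝ} (hτ : 0 < τ) : seMap₂ (seInv₂ τ) = τ := by
  rw [seMap₂_ofReal, seInv₂, Real.exp_log hτ]

theorem seMap₃_seInv₃ {τ : ℝ} (hτ : 0 < τ) : seMap₃ (seInv₃ τ) = τ := by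
  rw [seMap₃_ofReal, seInv₃, Real.exp_log (Real.sinh_pos_iff.mpr hτ), Real.arsinh_sinh]

end

/-!
Substituting `t = ψ x` turns the integral into one over `(-∞, ξ]` of `g = (f ∘ ψ) * ψ'`, which is
holomorphic and exponentially decaying in the strip. By Cauchy's formula on the strip, the remainder
of the cardinal series of `g` is the boundary integral of `g` against the remainder of the cardinal
series of the Cauchy kernel `t ↦ 1 / (z - t)`. That remainder carries the factor
`sin (π t / h) / sin (π z / h)`; integrating it by parts in `t` gains one factor `h`, while
`|sin (π z / h)| ≥ sinh (π d / h)` on the boundary provides the exponential smallness. Since `sinc`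
is only conditionally integrable, the integration in `t` starts at a half-integer multiple
`-(m + 1 / 2) h` and `m → ∞` at the end. Truncating the series costs a geometric tail, because
`|Si| ≤ 0.6 π` bounds every `J(k, h)` by `1.1 h`.

Both maps factor through `w = exp ζ`, which stays in the sector `cos d * |w| ≤ Re w`; there
`|1 + w²| ≥ cos d * (1 + |w|²)`, and this bounds all the denominators occurring in `E₂` and `E₃`.
-/

noncomputable section

open Filter Set
open Complex (I)
open scoped Real Topology

/-! ### The sine integral -/

theorem sineIntegral_eq_integral_sinc (x : ℝ) :
    sineIntegral x = ∫ σ in (0 : ℝ)..x, Real.sinc σ := by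
  refine intervalIntegral.integral_congr_ae ?_
  filter_upwards [Measure.ae_ne volume (0 : ℝ)] with σ hσ _
  rw [Real.sinc_of_ne_zero hσ]

theorem hasDerivAt_sineIntegral (x : ℝ) : HasDerivAt sineIntegral (Real.sinc x) x := by
  rw [funext sineIntegral_eq_integral_sinc]
  exact (Real.continuous_sinc.integral_hasStrictDerivAt 0 x).hasDerivAt

theorem continuous_sineIntegral : Continuous sineIntegral :=
  continuous_iff_continuousAt.mpr fun x => (hasDerivAt_sineIntegral x).continuousAt

theorem sineIntegral_zero : sineIntegral 0 = 0 := by simp [sineIntegral]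

theorem sineIntegral_neg (x : ℝ) : sineIntegral (-x) = -sineIntegral x := by
  have h := intervalIntegral.integral_comp_neg (a := 0) (b := x) Real.sinc
  simp only [Real.sinc_neg, neg_zero] at h
  rw [sineIntegral_eq_integral_sinc, sineIntegral_eq_integral_sinc, h,
    intervalIntegral.integral_symm]

theorem nonneg_of_hasDerivAt_nonneg {F F' : ℝ → ℝ} (hF : ∀ x, HasDerivAt F (F' x) x)
    (hF₀ : 0 ≤ F 0) (hF' : ∀ x, 0 ≤ x → 0 ≤ F' x) {x : ℝ} (hx : 0 ≤ x) : 0 ≤ F x := by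
  have hmono : MonotoneOn F (Ici 0) := by
    refine monotoneOn_of_hasDerivWithinAt_nonneg (convex_Ici 0)
      (fun y _ => (hF y).continuousAt.continuousWithinAt)
      (fun y _ => (hF y).hasDerivWithinAt) fun y hy => hF' y ?_
    rw [interior_Ici] at hy
    exact hy.le
  exact hF₀.trans (hmono self_mem_Ici hx hx)

/-- The Taylor polynomial of `cos` at `0` with `n` nonzero terms. -/
def cosTaylor (n : ℕ) (x : ℝ) : ℝ :=
  ∑ k ∈ Finset.range n, (-1) ^ k * (x ^ (2 * k) / (2 * k).factorial)

/-- The Taylor polynomial of `sin` at `0` with `n` nonzero terms. -/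
def sinTaylor (n : ℕ) (x : ℝ) : ℝ :=
  ∑ k ∈ Finset.range n, (-1) ^ k * (x ^ (2 * k + 1) / (2 * k + 1).factorial)

/-- The Taylor polynomial of the sine integral at `0` with `n` nonzero terms. -/
def sineIntegralTaylor (n : ℕ) (x : ℝ) : ℝ :=
  ∑ k ∈ Finset.range n, (-1) ^ k * (x ^ (2 * k + 1) / ((2 * k + 1) * (2 * k + 1).factorial))

theorem hasDerivAt_pow_succ_div_factorial (m : ℕ) (x : ℝ) :
    HasDerivAt (fun y : ℝ => y ^ (m + 1) / (m + 1).factorial) (x ^ m / m.factorial) x := by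
  refine ((hasDerivAt_pow (m + 1) x).div_const _).congr_deriv ?_
  rw [Nat.factorial_succ, Nat.add_sub_cancel]
  push_cast
  field_simp

theorem hasDerivAt_sinTaylor (n : ℕ) (x : ℝ) : HasDerivAt (sinTaylor n) (cosTaylor n x) x :=
  HasDerivAt.fun_sum fun k _ => (hasDerivAt_pow_succ_div_factorial (2 * k) x).const_mul _

theorem hasDerivAt_cosTaylor_succ (n : ℕ) (x : ℝ) :
    HasDerivAt (cosTaylor (n + 1)) (-sinTaylor n x) x := by
  have hsucc : cosTaylor (n + 1) = fun y => ∑ k ∈ Finset.range n,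
      (-1 : ℝ) ^ (k + 1) * (y ^ (2 * k + 1 + 1) / (2 * k + 1 + 1).factorial) + 1 := by
    funext y
    simp [cosTaylor, Finset.sum_range_succ', mul_add]
  rw [hsucc]
  refine ((HasDerivAt.fun_sum fun k _ =>
    (hasDerivAt_pow_succ_div_factorial (2 * k + 1) x).const_mul _).add_const 1).congr_deriv ?_
  simp [sinTaylor, pow_succ]

theorem hasDerivAt_sineIntegralTaylor (n : ℕ) (x : ℝ) :
    HasDerivAt (sineIntegralTaylor n)
      (∑ k ∈ Finset.range n, (-1) ^ k * (x ^ (2 * k) / (2 * k + 1).factorial)) x := by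
  refine HasDerivAt.fun_sum fun k _ => HasDerivAt.const_mul _ ?_
  refine ((hasDerivAt_pow (2 * k + 1) x).div_const _).congr_deriv ?_
  rw [Nat.add_sub_cancel]
  push_cast
  field_simp

theorem cosTaylor_sub_cos_sinTaylor_sub_sin_nonneg (n : ℕ) :
    (∀ x : ℝ, 0 ≤ x → 0 ≤ (-1) ^ n * (cosTaylor (n + 1) x - Real.cos x)) ∧
      ∀ x : ℝ, 0 ≤ x → 0 ≤ (-1) ^ n * (sinTaylor (n + 1) x - Real.sin x) := by
  have hsin (n : ℕ) (hcos : ∀ x : ℝ, 0 ≤ x → 0 ≤ (-1) ^ n * (cosTaylor (n + 1) x - Real.cos x))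
      (x : ℝ) (hx : 0 ≤ x) : 0 ≤ (-1) ^ n * (sinTaylor (n + 1) x - Real.sin x) :=
    nonneg_of_hasDerivAt_nonneg
      (fun y => ((hasDerivAt_sinTaylor (n + 1) y).sub (Real.hasDerivAt_sin y)).const_mul _)
      (by simp [sinTaylor]) hcos hx
  induction n with
  | zero =>
    have hcos (x : ℝ) (_ : 0 ≤ x) : 0 ≤ (-1) ^ 0 * (cosTaylor (0 + 1) x - Real.cos x) := by
      simpa [cosTaylor] using Real.cos_le_one x
    exact ⟨hcos, hsin 0 hcos⟩
  | succ n ih =>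
    have hcos (x : ℝ) (hx : 0 ≤ x) :
        0 ≤ (-1) ^ (n + 1) * (cosTaylor (n + 1 + 1) x - Real.cos x) := by
      refine nonneg_of_hasDerivAt_nonneg
        (fun y => ((hasDerivAt_cosTaylor_succ (n + 1) y).sub
          (Real.hasDerivAt_cos y)).const_mul _)
        (by simp [cosTaylor, Finset.sum_range_succ']) (fun y hy => ?_) hx
      convert ih.2 y hy using 1
      ring
    exact ⟨hcos, hsin (n + 1) hcos⟩

theorem sineIntegralTaylor_sub_sineIntegral_nonneg (n : ℕ) {x : ℝ} (hx : 0 ≤ x) :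
    0 ≤ (-1) ^ n * (sineIntegralTaylor (n + 1) x - sineIntegral x) := by
  refine nonneg_of_hasDerivAt_nonneg
    (fun y => ((hasDerivAt_sineIntegralTaylor (n + 1) y).sub
      (hasDerivAt_sineIntegral y)).const_mul _)
    (by simp [sineIntegralTaylor, sineIntegral_zero]) (fun y hy => ?_) hx
  rcases hy.eq_or_lt with rfl | hpos
  · simp [Finset.sum_range_succ']
  · rw [Real.sinc_of_ne_zero hpos.ne']
    refine (div_nonneg ((cosTaylor_sub_cos_sinTaylor_sub_sin_nonneg n).2 y hy) hy).trans_eq ?_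
    rw [mul_div_assoc, sub_div, sinTaylor, Finset.sum_div]
    congr! 3 with k
    field_simp
    ring

theorem sineIntegral_pi_le : sineIntegral π ≤ 0.6 * π := by
  have htaylor : sineIntegral π ≤
      π - π ^ 3 / 18 + π ^ 5 / 600 - π ^ 7 / 35280 + π ^ 9 / 3265920 := by
    have h := sineIntegralTaylor_sub_sineIntegral_nonneg 4 Real.pi_pos.le
    norm_num [sineIntegralTaylor, Finset.sum_range_succ, Nat.factorial] at h
    linarith
  have hlt := Real.pi_lt_d4.le
  have hgt := Real.pi_gt_d4.le
  have h₃ : (3.1415 : ℝ) ^ 3 ≤ π ^ 3 := by gcongr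
  have h₅ : π ^ 5 ≤ 3.1416 ^ 5 := by gcongr
  have h₇ : (3.1415 : ℝ) ^ 7 ≤ π ^ 7 := by gcongr
  have h₉ : π ^ 9 ≤ 3.1416 ^ 9 := by gcongr
  norm_num at h₃ h₅ h₇ h₉ ⊢
  linarith

theorem monotoneOn_sineIntegral : MonotoneOn sineIntegral (Icc 0 π) := by
  refine monotoneOn_of_hasDerivWithinAt_nonneg (convex_Icc 0 _)
    continuous_sineIntegral.continuousOn
    (fun y _ => (hasDerivAt_sineIntegral y).hasDerivWithinAt) fun y hy => ?_
  rw [interior_Icc] at hy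
  rw [Real.sinc_of_ne_zero hy.1.ne']
  exact div_nonneg (Real.sin_nonneg_of_mem_Icc ⟨hy.1.le, hy.2.le⟩) hy.1.le

theorem hasDerivAt_sineIntegral_add_div (c : ℝ) {y : ℝ} (hy : y ≠ 0) :
    HasDerivAt (fun y => sineIntegral y + (c + Real.cos y) / y) (-(c + Real.cos y) / y ^ 2) y := by
  refine ((hasDerivAt_sineIntegral y).add
    (((Real.hasDerivAt_cos y).const_add c).div (hasDerivAt_id y) hy)).congr_deriv ?_
  rw [Real.sinc_of_ne_zero hy]
  simp only [id]
  field_simp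
  ring

theorem sineIntegral_le_of_pi_le {x : ℝ} (hx : π ≤ x) : sineIntegral x ≤ sineIntegral π := by
  have hne : ∀ y ∈ Ici π, y ≠ 0 := fun y hy => (Real.pi_pos.trans_le hy).ne'
  have hanti : AntitoneOn (fun y => sineIntegral y + (1 + Real.cos y) / y) (Ici π) :=
    antitoneOn_of_hasDerivWithinAt_nonpos (convex_Ici _)
      (fun y hy => (hasDerivAt_sineIntegral_add_div 1 (hne y hy)).continuousAt.continuousWithinAt)
      (fun y hy => (hasDerivAt_sineIntegral_add_div 1
        (hne y (interior_subset hy))).hasDerivWithinAt)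
      fun y _ => div_nonpos_of_nonpos_of_nonneg (by linarith [Real.neg_one_le_cos y]) (sq_nonneg y)
  have hle : sineIntegral x + (1 + Real.cos x) / x ≤ sineIntegral π := by
    simpa using hanti self_mem_Ici hx hx
  have hnonneg : 0 ≤ (1 + Real.cos x) / x :=
    div_nonneg (by linarith [Real.neg_one_le_cos x]) (Real.pi_pos.le.trans hx)
  linarith

theorem le_sineIntegral_of_pi_le {x : ℝ} (hx : π ≤ x) :
    sineIntegral π - 2 / π ≤ sineIntegral x := by
  have hne : ∀ y ∈ Ici π, y ≠ 0 := fun y hy => (Real.pi_pos.trans_le hy).ne'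
  have hmono : MonotoneOn (fun y => sineIntegral y + (-1 + Real.cos y) / y) (Ici π) :=
    monotoneOn_of_hasDerivWithinAt_nonneg (convex_Ici _)
      (fun y hy => (hasDerivAt_sineIntegral_add_div _ (hne y hy)).continuousAt.continuousWithinAt)
      (fun y hy => (hasDerivAt_sineIntegral_add_div _
        (hne y (interior_subset hy))).hasDerivWithinAt)
      fun y _ => div_nonneg (by linarith [Real.cos_le_one y]) (sq_nonneg y)
  have hle : sineIntegral π + (-1 + Real.cos π) / π ≤
      sineIntegral x + (-1 + Real.cos x) / x := hmono self_mem_Ici hx hx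
  have hnonpos : (-1 + Real.cos x) / x ≤ 0 :=
    div_nonpos_of_nonpos_of_nonneg (by linarith [Real.cos_le_one x]) (Real.pi_pos.le.trans hx)
  rw [Real.cos_pi, show (-1 + -1 : ℝ) = -2 by norm_num, neg_div] at hle
  linarith

theorem abs_sineIntegral_le (x : ℝ) : |sineIntegral x| ≤ 0.6 * π := by
  wlog hx : 0 ≤ x generalizing x
  · simpa only [sineIntegral_neg, abs_neg] using this (-x) (by linarith)
  have hπ := Real.pi_pos
  have hzero : (0 : ℝ) ∈ Icc 0 π := left_mem_Icc.mpr hπ.le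
  have hpi : π ∈ Icc 0 π := right_mem_Icc.mpr hπ.le
  rw [abs_le]
  rcases le_total x π with hxπ | hxπ
  · have hupper := monotoneOn_sineIntegral ⟨hx, hxπ⟩ hpi hxπ
    have hlower := monotoneOn_sineIntegral hzero ⟨hx, hxπ⟩ hx
    rw [sineIntegral_zero] at hlower
    exact ⟨by linarith, hupper.trans sineIntegral_pi_le⟩
  · have hpi_nonneg : 0 ≤ sineIntegral π := by
      simpa only [sineIntegral_zero] using monotoneOn_sineIntegral hzero hpi hπ.le
    have htwo : 2 / π ≤ 0.6 * π := by
      rw [div_le_iff₀ hπ]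
      nlinarith [Real.pi_gt_three]
    exact ⟨by linarith [le_sineIntegral_of_pi_le hxπ],
      (sineIntegral_le_of_pi_le hxπ).trans sineIntegral_pi_le⟩

theorem abs_sincJ_le {h : ℝ} (hh : 0 ≤ h) (k : ℤ) (x : ℝ) : |sincJ k h x| ≤ 1.1 * h := by
  have hSi := abs_sineIntegral_le (π * (x / h - k))
  rw [sincJ, abs_mul, abs_of_nonneg hh, mul_comm]
  gcongr
  calc |1 / 2 + 1 / π * sineIntegral (π * (x / h - k))|
      ≤ |1 / 2| + |1 / π * sineIntegral (π * (x / h - k))| := abs_add_le _ _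
    _ ≤ 1 / 2 + 1 / π * (0.6 * π) := by
      rw [abs_mul, abs_of_pos (one_div_pos.mpr Real.pi_pos), abs_of_pos one_half_pos]
      gcongr
    _ = 1.1 := by
      field_simp
      norm_num

theorem sin_div_two_mul_sin_half_eq_sum_cos (n : ℕ) {x : ℝ} (hx : Real.sin (x / 2) ≠ 0) :
    Real.sin ((n + 1 / 2) * x) / (2 * Real.sin (x / 2)) =
      1 / 2 + ∑ j ∈ Finset.range n, Real.cos ((j + 1) * x) := by
  rw [div_eq_iff (by positivity)]
  induction n with
  | zero =>
    simp only [CharP.cast_eq_zero, Finset.range_zero, Finset.sum_empty]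
    ring_nf
  | succ m ih =>
    have hadd : ((m + 1 : ℕ) + 1 / 2 : ℝ) * x = (m + 1) * x + x / 2 := by push_cast; ring
    have hsub : ((m : ℝ) + 1 / 2) * x = (m + 1) * x - x / 2 := by ring
    rw [Finset.sum_range_succ, ← add_assoc, add_mul (1 / 2 + _), ← ih, hadd, hsub,
      Real.sin_add, Real.sin_sub]
    ring

theorem sin_half_pos {x : ℝ} (hx : x ∈ Ioc 0 π) : 0 < Real.sin (x / 2) :=
  Real.sin_pos_of_pos_of_lt_pi (by linarith [hx.1]) (by linarith [hx.2, Real.pi_pos])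

theorem integral_sin_div_two_mul_sin_half (n : ℕ) :
    ∫ x in (0 : ℝ)..π, Real.sin ((n + 1 / 2) * x) / (2 * Real.sin (x / 2)) = π / 2 := by
  have hcos (j : ℕ) : ∫ x in (0 : ℝ)..π, Real.cos ((j + 1) * x) = 0 := by
    have hj : (j : ℝ) + 1 ≠ 0 := by positivity
    have hsin := Real.sin_nat_mul_pi (j + 1)
    push_cast at hsin
    rw [intervalIntegral.integral_comp_mul_left (fun y => Real.cos y) hj, integral_cos, hsin]
    simp
  rw [intervalIntegral.integral_congr_ae (Eventually.of_forall fun x hx =>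
      sin_div_two_mul_sin_half_eq_sum_cos n
        (sin_half_pos (uIoc_of_le Real.pi_pos.le ▸ hx)).ne'),
    intervalIntegral.integral_add (by simp) (Continuous.intervalIntegrable (by fun_prop) _ _),
    intervalIntegral.integral_finsetSum
      fun i _ => (Continuous.intervalIntegrable (by fun_prop) _ _),
    Finset.sum_eq_zero fun j _ => hcos j, intervalIntegral.integral_const, smul_eq_mul]
  ring

theorem abs_inv_sub_inv_two_mul_sin_half_le {x : ℝ} (hx : x ∈ Ioc 0 π) :
    |1 / x - 1 / (2 * Real.sin (x / 2))| ≤ 1 := by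
  obtain ⟨hx₀, hxπ⟩ := hx
  have hpos := sin_half_pos ⟨hx₀, hxπ⟩
  have hupper : Real.sin (x / 2) ≤ x / 2 := Real.sin_le (by linarith)
  have hcubic : x / 2 - (x / 2) ^ 3 / 6 < Real.sin (x / 2) :=
    Real.sin_gt_sub_cube (by linarith)
  have hlinear : x ≤ 4 * Real.sin (x / 2) := by
    have hjordan := Real.mul_le_sin (x := x / 2) (by linarith) (by linarith)
    rw [div_mul_div_comm, mul_comm π 2, mul_div_mul_left _ _ two_ne_zero,
      div_le_iff₀ Real.pi_pos] at hjordan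
    nlinarith [Real.pi_le_four]
  rw [abs_sub_comm, abs_of_nonneg]
  · rw [div_sub_div _ _ (by positivity) hx₀.ne', div_le_one (by positivity)]
    have hsq : x ^ 2 ≤ 4 * x := by nlinarith [Real.pi_le_four]
    nlinarith [mul_nonneg hx₀.le hpos.le, mul_le_mul_of_nonneg_left hsq hx₀.le,
      mul_le_mul_of_nonneg_left hlinear hx₀.le]
  · rw [sub_nonneg]
    exact one_div_le_one_div_of_le (by positivity) (by linarith)

theorem integrableOn_inv_sub_inv_two_mul_sin_half :
    IntegrableOn (fun x => 1 / x - 1 / (2 * Real.sin (x / 2))) (Ioc 0 π) :=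
  Measure.integrableOn_of_bounded (M := 1) (by simp)
    (Measurable.aestronglyMeasurable (by fun_prop))
    ((ae_restrict_iff' measurableSet_Ioc).mpr
      (Eventually.of_forall fun _ hx => abs_inv_sub_inv_two_mul_sin_half_le hx))

theorem tendsto_integral_sin_mul_atTop {φ : ℝ → ℝ} (hφ : Integrable φ) :
    Tendsto (fun w => ∫ v, Real.sin (w * v) * φ v) atTop (𝓝 0) := by
  have hscale : Tendsto (fun w : ℝ => w / (2 * π)) atTop (cocompact ℝ) :=
    (tendsto_id.atTop_div_const Real.two_pi_pos).mono_right atTop_le_cocompact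
  have hRL := (Complex.continuous_im.tendsto _).comp
    ((Real.tendsto_integral_exp_smul_cocompact fun v => (φ v : ℂ)).comp hscale)
  have him (w : ℝ) : (∫ v, Real.fourierChar (-(v * (w / (2 * π)))) • (φ v : ℂ)).im =
      -∫ v, Real.sin (w * v) * φ v := by
    have hint : Integrable fun v => Real.fourierChar (-(v * (w / (2 * π)))) • (φ v : ℂ) :=
      (VectorFourier.fourierIntegral_convergent_iff (L := LinearMap.mul ℝ ℝ)
        Real.continuous_fourierChar continuous_mul _).mpr hφ.ofReal
    rw [← Complex.imCLM_apply, ← Complex.imCLM.integral_comp_comm hint, ← integral_neg]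
    refine integral_congr_ae (Eventually.of_forall fun v => ?_)
    have hphase : 2 * π * -(v * (w / (2 * π))) = -(w * v) := by field_simp
    simp only [Circle.smul_def, Real.fourierChar_apply, smul_eq_mul, Complex.imCLM_apply,
      Complex.im_mul_ofReal, Complex.exp_ofReal_mul_I_im, hphase, Real.sin_neg, neg_mul]
  simpa only [Function.comp_def, him, Complex.zero_im, neg_neg, neg_zero] using hRL.neg

theorem sineIntegral_half_integer_eq (n : ℕ) :
    sineIntegral (π * (n + 1 / 2)) = π / 2 + ∫ v in Ioc 0 π,
      Real.sin ((n + 1 / 2) * v) * (1 / v - 1 / (2 * Real.sin (v / 2))) := by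
  have hint_sinc : IntervalIntegrable (fun v : ℝ =>
      (n + 1 / 2) * Real.sinc ((n + 1 / 2) * v)) volume 0 π :=
    Continuous.intervalIntegrable
      (continuous_const.mul (Real.continuous_sinc.comp (by fun_prop))) _ _
  have hint_kernel : IntervalIntegrable (fun v : ℝ =>
      Real.sin ((n + 1 / 2) * v) / (2 * Real.sin (v / 2))) volume 0 π :=
    intervalIntegral.intervalIntegrable_of_integral_ne_zero
      (by rw [integral_sin_div_two_mul_sin_half]; positivity)
  have hsub : ∫ v in Ioc 0 π,
      Real.sin ((n + 1 / 2) * v) * (1 / v - 1 / (2 * Real.sin (v / 2))) =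
      ∫ v in (0 : ℝ)..π, ((n + 1 / 2) * Real.sinc ((n + 1 / 2) * v) -
        Real.sin ((n + 1 / 2) * v) / (2 * Real.sin (v / 2))) := by
    rw [intervalIntegral.integral_of_le Real.pi_pos.le]
    refine setIntegral_congr_fun measurableSet_Ioc fun v hv => ?_
    have hv₀ : v ≠ 0 := hv.1.ne'
    rw [Real.sinc_of_ne_zero (by positivity)]
    field_simp
  rw [hsub, intervalIntegral.integral_sub hint_sinc hint_kernel,
    integral_sin_div_two_mul_sin_half, intervalIntegral.integral_const_mul,
    intervalIntegral.mul_integral_comp_mul_left (f := Real.sinc), sineIntegral_eq_integral_sinc,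
    mul_zero, mul_comm π]
  ring

theorem tendsto_sineIntegral_half_integer :
    Tendsto (fun n : ℕ => sineIntegral (π * (n + 1 / 2))) atTop (𝓝 (π / 2)) := by
  have hRL := (tendsto_integral_sin_mul_atTop
    (integrableOn_inv_sub_inv_two_mul_sin_half.integrable_indicator measurableSet_Ioc)).comp
      (tendsto_natCast_atTop_atTop.atTop_add (tendsto_const_nhds (x := (1 / 2 : ℝ))))
  refine (add_zero (π / 2) ▸ hRL.const_add (π / 2)).congr fun n => ?_
  rw [sineIntegral_half_integer_eq, ← integral_indicator measurableSet_Ioc]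
  simp only [Function.comp_apply, indicator_mul_right]

/-! ### Interpolation of the Cauchy kernel by the cardinal series -/

theorem hasSum_fourier_series_zero {F : ℝ → ℂ} (hF : Continuous F) (hper : F (-π) = F π)
    (hs : Summable fun k : ℤ =>
      ((2 * π : ℝ) : ℂ)⁻¹ * ∫ θ in (-π)..π, Complex.exp (-(k * I * θ)) * F θ) :
    HasSum (fun k : ℤ => ((2 * π : ℝ) : ℂ)⁻¹ * ∫ θ in (-π)..π, Complex.exp (-(k * I * θ)) * F θ)
      (F 0) := by
  have : Fact (0 < 2 * π) := ⟨Real.two_pi_pos⟩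
  have hend : -π + 2 * π = π := by ring
  let G : C(AddCircle (2 * π), ℂ) := ⟨AddCircle.liftIco (2 * π) (-π) F,
    AddCircle.liftIco_continuous (by rw [hper, hend]) hF.continuousOn⟩
  have hcoeff (k : ℤ) : fourierCoeff G k =
      ((2 * π : ℝ) : ℂ)⁻¹ * ∫ θ in (-π)..π, Complex.exp (-(k * I * θ)) * F θ := by
    have hlift : fourierCoeff G k = _ := fourierCoeff_liftIco_eq F k
    rw [hlift, fourierCoeffOn_eq_integral, add_sub_cancel_left, hend, Complex.real_smul,
      Complex.ofReal_div, Complex.ofReal_one, one_div]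
    congr 2 with θ
    rw [fourier_coe_apply, smul_eq_mul]
    congr 2
    push_cast
    field_simp
  have hzero : G 0 = F 0 :=
    AddCircle.liftIco_coe_apply (x := (0 : ℝ))
      ⟨by linarith [Real.pi_pos], by linarith [Real.pi_pos]⟩
  have hsum := has_pointwise_sum_fourier_series_of_summable (f := G)
    (by rwa [funext hcoeff]) 0
  simpa only [hcoeff, hzero, fourier_eval_zero, smul_eq_mul, mul_one] using hsum

theorem integral_exp_mul_I_neg_pi_pi {a : ℂ} (ha : a ≠ 0) :
    ∫ θ in (-π)..π, Complex.exp (a * I * θ) = 2 * Complex.sin (π * a) / a := by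
  rw [integral_exp_mul_complex (mul_ne_zero ha Complex.I_ne_zero), Complex.sin]
  push_cast
  field_simp
  rw [Complex.I_sq]
  ring_nf

theorem mul_sinc (x : ℝ) : x * Real.sinc x = Real.sin x := by
  rcases eq_or_ne x 0 with rfl | hx
  · simp
  · rw [Real.sinc_of_ne_zero hx, mul_div_cancel₀ _ hx]

theorem integral_exp_ofReal_mul_I_neg_pi_pi (a : ℝ) :
    ∫ θ in (-π)..π, Complex.exp (a * I * θ) = 2 * π * Real.sinc (π * a) := by
  rcases eq_or_ne a 0 with rfl | ha
  · simp only [Complex.ofReal_zero, zero_mul, Complex.exp_zero, intervalIntegral.integral_const,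
      sub_neg_eq_add, mul_zero, Real.sinc_zero, Complex.ofReal_one, Complex.real_smul, mul_one,
      Complex.ofReal_add]
    ring
  · have ha' : (a : ℂ) ≠ 0 := by exact_mod_cast ha
    rw [integral_exp_mul_I_neg_pi_pi ha', div_eq_iff ha']
    have h := congrArg ((↑) : ℝ → ℂ) (mul_sinc (π * a))
    push_cast at h
    linear_combination -2 * h

theorem sin_pi_mul_sub_int (z : ℂ) (k : ℤ) :
    Complex.sin (π * (z - k)) = (-1) ^ k * Complex.sin (π * z) := by
  have hcos : Complex.cos (k * π) = (-1) ^ k := by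
    simpa using congrArg ((↑) : ℝ → ℂ) (Real.cos_int_mul_pi k)
  rw [mul_sub, mul_comm (π : ℂ) k, Complex.sin_sub, hcos, Complex.sin_int_mul_pi]
  ring

theorem sub_ofReal_ne_zero {w : ℂ} (hw : w.im ≠ 0) (x : ℝ) : w - x ≠ 0 := fun h =>
  hw (by simpa using congrArg Complex.im h)

theorem abs_im_le_norm_sub_ofReal (w : ℂ) (x : ℝ) : |w.im| ≤ ‖w - x‖ := by
  simpa using Complex.abs_im_le_norm (w - x)

theorem norm_sub_ofReal_sq (w : ℂ) (x : ℝ) : ‖w - x‖ ^ 2 = (x - w.re) ^ 2 + w.im ^ 2 := by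
  rw [← Complex.normSq_eq_norm_sq, Complex.normSq_apply]
  simp only [Complex.sub_re, Complex.ofReal_re, Complex.sub_im, Complex.ofReal_im, sub_zero]
  ring

theorem sinh_abs_im_le_norm_sin (w : ℂ) : Real.sinh |w.im| ≤ ‖Complex.sin w‖ := by
  rw [← Real.abs_sinh, Complex.sin, norm_div, norm_mul, Complex.norm_I, mul_one,
    Complex.norm_ofNat, Real.sinh_eq, abs_div, abs_of_pos (two_pos : (0 : ℝ) < 2)]
  gcongr
  simpa [Complex.norm_exp] using
    abs_norm_sub_norm_le (Complex.exp (-w * I)) (Complex.exp (w * I))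

theorem sinh_pi_mul_abs_im_le_norm_sin (w : ℂ) :
    Real.sinh (π * |w.im|) ≤ ‖Complex.sin (π * w)‖ := by
  simpa [abs_mul, abs_of_pos Real.pi_pos] using sinh_abs_im_le_norm_sin (π * w)

theorem sin_pi_mul_ne_zero_of_im_ne_zero {w : ℂ} (hw : w.im ≠ 0) : Complex.sin (π * w) ≠ 0 :=
  norm_pos_iff.mp ((Real.sinh_pos_iff.mpr (mul_pos Real.pi_pos (abs_pos.mpr hw))).trans_le
    (sinh_pi_mul_abs_im_le_norm_sin w))

theorem one_add_abs_mul_abs_sinc_le (t : ℝ) (k : ℤ) :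
    (1 + |(k : ℝ)|) * |Real.sinc (π * (t - k))| ≤ 2 + |t| := by
  have hsin : |π * (t - k)| * |Real.sinc (π * (t - k))| ≤ 1 := by
    rw [← abs_mul, mul_sinc]
    exact Real.abs_sin_le_one _
  have hpi : |t - k| ≤ |π * (t - k)| := by
    rw [abs_mul, abs_of_pos Real.pi_pos]
    exact le_mul_of_one_le_left (abs_nonneg _) (by linarith [Real.pi_gt_three])
  have hk : |(k : ℝ)| ≤ |t| + |t - k| := by
    linarith [abs_sub_abs_le_abs_sub (k : ℝ) t, abs_sub_comm (k : ℝ) t]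
  calc (1 + |(k : ℝ)|) * |Real.sinc (π * (t - k))|
      ≤ (1 + |t| + |π * (t - k)|) * |Real.sinc (π * (t - k))| := by
        refine mul_le_mul_of_nonneg_right ?_ (abs_nonneg _)
        linarith
    _ = (1 + |t|) * |Real.sinc (π * (t - k))| + |π * (t - k)| * |Real.sinc (π * (t - k))| := by
        ring
    _ ≤ (1 + |t|) * 1 + 1 := by
        gcongr
        exact Real.abs_sinc_le_one _
    _ = 2 + |t| := by ring

theorem one_add_abs_le_mul_norm_sub_int {w : ℂ} (hw : w.im ≠ 0) (k : ℤ) :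
    1 + |(k : ℝ)| ≤ (1 / |w.im| + 1) * (1 + |w.re|) * ‖w - k‖ := by
  have him : |w.im| ≤ ‖w - k‖ := by simpa using abs_im_le_norm_sub_ofReal w k
  have hre : |w.re - k| ≤ ‖w - k‖ := by simpa using Complex.abs_re_le_norm (w - k)
  have hk : |(k : ℝ)| ≤ |w.re| + |w.re - k| := by
    linarith [abs_sub_abs_le_abs_sub (k : ℝ) w.re, abs_sub_comm (k : ℝ) w.re]
  have hfar : 1 + |w.re| ≤ 1 / |w.im| * (1 + |w.re|) * ‖w - k‖ := by
    calc 1 + |w.re| = 1 / |w.im| * (1 + |w.re|) * |w.im| := by field_simp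
      _ ≤ 1 / |w.im| * (1 + |w.re|) * ‖w - k‖ := by gcongr
  have hnear : ‖w - k‖ ≤ (1 + |w.re|) * ‖w - k‖ :=
    le_mul_of_one_le_left (norm_nonneg _) (by linarith [abs_nonneg w.re])
  linarith

theorem norm_sinc_div_sub_int_le (t : ℝ) {w : ℂ} (hw : w.im ≠ 0) (k : ℤ) :
    ‖(Real.sinc (π * (t - k)) : ℂ) / (w - k)‖ ≤
      (2 + |t|) * ((1 / |w.im| + 1) * (1 + |w.re|)) * (1 / (1 + |(k : ℝ)|)) ^ 2 := by
  have hnorm : 0 < ‖w - k‖ := norm_pos_iff.mpr (by simpa using sub_ofReal_ne_zero hw k)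
  rw [norm_div, Complex.norm_real, Real.norm_eq_abs, div_pow, one_pow, mul_one_div,
    div_le_div_iff₀ hnorm (by positivity)]
  calc |Real.sinc (π * (t - k))| * (1 + |(k : ℝ)|) ^ 2
      = ((1 + |(k : ℝ)|) * |Real.sinc (π * (t - k))|) * (1 + |(k : ℝ)|) := by ring
    _ ≤ (2 + |t|) * ((1 / |w.im| + 1) * (1 + |w.re|) * ‖w - k‖) :=
        mul_le_mul (one_add_abs_mul_abs_sinc_le t k) (one_add_abs_le_mul_norm_sub_int hw k)
          (by positivity) (by positivity)
    _ = (2 + |t|) * ((1 / |w.im| + 1) * (1 + |w.re|)) * ‖w - k‖ := by ring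

theorem summable_inv_one_add_abs_sq : Summable fun k : ℤ => (1 / (1 + |(k : ℝ)|)) ^ 2 := by
  have hnat : Summable fun n : ℕ => (1 / (1 + (n : ℝ))) ^ 2 := by
    refine ((summable_nat_add_iff 1).mpr
      (Real.summable_one_div_nat_pow.mpr one_lt_two)).congr fun n => ?_
    push_cast
    rw [div_pow, one_pow, add_comm (n : ℝ)]
  refine Summable.of_nat_of_neg ?_ ?_ <;> simpa using hnat

theorem summable_sinc_div_sub_int (t : ℝ) {w : ℂ} (hw : w.im ≠ 0) :
    Summable fun k : ℤ => (Real.sinc (π * (t - k)) : ℂ) / (w - k) :=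
  (summable_inv_one_add_abs_sq.mul_left _).of_norm_bounded (norm_sinc_div_sub_int_le t hw)

theorem integral_exp_mul_interpolant (t : ℝ) {w : ℂ} (hw : w.im ≠ 0) (k : ℤ) :
    ∫ θ in (-π)..π, Complex.exp (-(k * I * θ)) * ((Complex.exp (t * I * θ) -
      Complex.sin (π * t) / Complex.sin (π * w) * Complex.exp (w * I * θ)) / (w - t)) =
      2 * π * (Real.sinc (π * (t - k)) / (w - k)) := by
  have hwk : w - k ≠ 0 := by simpa using sub_ofReal_ne_zero hw k
  have hwt := sub_ofReal_ne_zero hw t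
  have hsin := sin_pi_mul_ne_zero_of_im_ne_zero hw
  have hsplit (θ : ℝ) : Complex.exp (-(k * I * θ)) * ((Complex.exp (t * I * θ) -
      Complex.sin (π * t) / Complex.sin (π * w) * Complex.exp (w * I * θ)) / (w - t)) =
      (Complex.exp (((t - k : ℝ) : ℂ) * I * θ) -
        Complex.sin (π * t) / Complex.sin (π * w) * Complex.exp ((w - k) * I * θ)) / (w - t) := by
    rw [mul_div_assoc', mul_sub, mul_left_comm, ← Complex.exp_add, ← Complex.exp_add]
    push_cast
    ring_nf
  have hsinc : (π : ℂ) * (t - k) * Real.sinc (π * (t - k)) =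
      (-1) ^ k * Complex.sin (π * t) := by
    rw [← sin_pi_mul_sub_int]
    exact_mod_cast congrArg ((↑) : ℝ → ℂ) (mul_sinc (π * (t - k)))
  simp_rw [hsplit]
  rw [intervalIntegral.integral_div, intervalIntegral.integral_sub
      (Continuous.intervalIntegrable (by fun_prop) _ _)
      (Continuous.intervalIntegrable (by fun_prop) _ _), intervalIntegral.integral_const_mul,
    integral_exp_ofReal_mul_I_neg_pi_pi, integral_exp_mul_I_neg_pi_pi hwk, sin_pi_mul_sub_int]
  have hcancel : Complex.sin (π * t) / Complex.sin (π * w) *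
      (2 * ((-1) ^ k * Complex.sin (π * w)) / (w - k)) =
      2 * (π * (t - k) * Real.sinc (π * (t - k))) / (w - k) := by
    rw [hsinc]
    field_simp
  rw [hcancel]
  field_simp
  ring

-- The right-hand side is the value at `0` of a function of period `2π` in the frequency variable
-- `θ`, whose Fourier coefficients are the terms of the series.
theorem hasSum_sinc_div_sub_int (t : ℝ) {w : ℂ} (hw : w.im ≠ 0) :
    HasSum (fun k : ℤ => (Real.sinc (π * (t - k)) : ℂ) / (w - k))
      ((1 - Complex.sin (π * t) / Complex.sin (π * w)) / (w - t)) := by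
  have hsin := sin_pi_mul_ne_zero_of_im_ne_zero hw
  have hjump (a : ℂ) : Complex.exp (a * I * (π : ℝ)) - Complex.exp (a * I * (-π : ℝ)) =
      2 * I * Complex.sin (π * a) := by
    rw [Complex.sin]
    push_cast
    ring_nf
    rw [Complex.I_sq]
    ring
  have hper : (Complex.exp (t * I * (-π : ℝ)) -
      Complex.sin (π * t) / Complex.sin (π * w) * Complex.exp (w * I * (-π : ℝ))) / (w - t) =
      (Complex.exp (t * I * (π : ℝ)) -
        Complex.sin (π * t) / Complex.sin (π * w) * Complex.exp (w * I * (π : ℝ))) / (w - t) := by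
    congr 1
    linear_combination -hjump t + Complex.sin (π * t) / Complex.sin (π * w) * hjump w +
      2 * I * div_mul_cancel₀ (Complex.sin (π * t)) hsin
  have hcoeff (k : ℤ) := integral_exp_mul_interpolant t hw k
  have hpi : ((2 * π : ℝ) : ℂ) ≠ 0 := by exact_mod_cast Real.two_pi_pos.ne'
  have hterm (k : ℤ) : ((2 * π : ℝ) : ℂ)⁻¹ * (2 * π * (Real.sinc (π * (t - k)) / (w - k))) =
      Real.sinc (π * (t - k)) / (w - k) := by
    push_cast at hpi ⊢
    rw [inv_mul_cancel_left₀ hpi]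
  have hsum := hasSum_fourier_series_zero (F := fun θ : ℝ => (Complex.exp (t * I * θ) -
    Complex.sin (π * t) / Complex.sin (π * w) * Complex.exp (w * I * θ)) / (w - t))
    (by fun_prop) hper
    (by simpa only [hcoeff, hterm] using summable_sinc_div_sub_int t hw)
  simpa only [hcoeff, hterm, Complex.ofReal_zero, mul_zero, Complex.exp_zero, mul_one] using hsum

theorem integral_univ_inv_sub_sq_add_sq {y : ℝ} (hy : y ≠ 0) (x : ℝ) :
    ∫ s : ℝ, ((s - x) ^ 2 + y ^ 2)⁻¹ = π / |y| := by
  have hscale (s : ℝ) : (s ^ 2 + y ^ 2)⁻¹ = (y ^ 2)⁻¹ * (1 + (y⁻¹ * s) ^ 2)⁻¹ := by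
    rw [← mul_inv]
    congr 1
    field_simp
    ring
  have := abs_pos.mpr hy
  rw [integral_sub_right_eq_self (fun s : ℝ => (s ^ 2 + y ^ 2)⁻¹) x, integral_congr_ae
    (Eventually.of_forall hscale), integral_const_mul,
    Measure.integral_comp_mul_left (fun s : ℝ => (1 + s ^ 2)⁻¹),
    integral_univ_inv_one_add_sq, inv_inv, smul_eq_mul, ← sq_abs]
  field_simp

theorem integrable_inv_sub_sq_add_sq {y : ℝ} (hy : y ≠ 0) (x : ℝ) :
    Integrable fun s : ℝ => ((s - x) ^ 2 + y ^ 2)⁻¹ :=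
  Integrable.of_integral_ne_zero <| by
    rw [integral_univ_inv_sub_sq_add_sq hy]
    exact div_ne_zero Real.pi_ne_zero (abs_ne_zero.mpr hy)

theorem integral_sin_div_sub_eq_sub_integral {w : ℂ} (hw : w.im ≠ 0) {A ξ : ℝ}
    (hcos : Real.cos (π * A) = 0) :
    ∫ x in A..ξ, (Real.sin (π * x) : ℂ) / (w - x) =
      -(Real.cos (π * ξ) / π / (w - ξ)) +
        ∫ x in A..ξ, (Real.cos (π * x) / π : ℂ) / (w - x) ^ 2 := by
  have hne := sub_ofReal_ne_zero hw
  have hu (x : ℝ) : HasDerivAt (fun x : ℝ => (w - x)⁻¹) ((w - x) ^ 2)⁻¹ x := by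
    convert! ((Complex.ofRealCLM.hasDerivAt (x := x)).const_sub w).inv (hne x) using 1
    simp
  have hv (x : ℝ) : HasDerivAt (fun x : ℝ => (-(Real.cos (π * x) / π) : ℂ))
      (Real.sin (π * x) : ℂ) x := by
    have hcosx := ((((hasDerivAt_id x).const_mul π).cos).div_const π).neg.ofReal_comp
    convert! hcosx using 1
    · simp
    · simp
      field_simp
  have hcont : Continuous fun x : ℝ => ((w - x) ^ 2)⁻¹ :=
    Continuous.inv₀ (by fun_prop) fun x => pow_ne_zero 2 (hne x)
  have hparts := intervalIntegral.integral_mul_deriv_eq_deriv_mul (a := A) (b := ξ)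
    (fun x _ => hu x) (fun x _ => hv x)
    (hcont.intervalIntegrable _ _) (Continuous.intervalIntegrable (by fun_prop) _ _)
  simp only [hcos, Complex.ofReal_zero, zero_div, neg_zero, mul_zero, sub_zero, mul_neg,
    intervalIntegral.integral_neg, sub_neg_eq_add] at hparts
  simpa only [div_eq_inv_mul] using hparts

theorem norm_integral_cos_div_sub_sq_le {w : ℂ} (hw : w.im ≠ 0) {A ξ : ℝ} (hA : A ≤ ξ) :
    ‖∫ x in A..ξ, (Real.cos (π * x) / π : ℂ) / (w - x) ^ 2‖ ≤ 1 / |w.im| := by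
  have hbound (x : ℝ) : ‖(Real.cos (π * x) / π : ℂ) / (w - x) ^ 2‖ ≤
      1 / π * ((x - w.re) ^ 2 + w.im ^ 2)⁻¹ := by
    rw [norm_div, norm_pow, norm_sub_ofReal_sq, div_eq_mul_inv, norm_div, Complex.norm_real,
      Complex.norm_real, Real.norm_of_nonneg Real.pi_pos.le]
    gcongr
    exact Real.abs_cos_le_one _
  have hint := (integrable_inv_sub_sq_add_sq hw w.re).const_mul (1 / π)
  calc _ ≤ ∫ x in A..ξ, 1 / π * ((x - w.re) ^ 2 + w.im ^ 2)⁻¹ :=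
        intervalIntegral.norm_integral_le_of_norm_le hA
          (Eventually.of_forall fun x _ => hbound x) hint.intervalIntegrable
    _ ≤ ∫ x : ℝ, 1 / π * ((x - w.re) ^ 2 + w.im ^ 2)⁻¹ := by
        rw [intervalIntegral.integral_of_le hA]
        exact setIntegral_le_integral hint (Eventually.of_forall fun x => by positivity)
    _ = 1 / |w.im| := by
        rw [integral_const_mul, integral_univ_inv_sub_sq_add_sq hw]
        field_simp

theorem norm_integral_sin_div_sub_le {w : ℂ} (hw : w.im ≠ 0) {A ξ : ℝ} (hA : A ≤ ξ)
    (hcos : Real.cos (π * A) = 0) :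
    ‖∫ x in A..ξ, (Real.sin (π * x) : ℂ) / (w - x)‖ ≤ (1 / π + 1) / |w.im| := by
  have := abs_pos.mpr hw
  have hboundary : ‖-((Real.cos (π * ξ) : ℂ) / π / (w - ξ))‖ ≤ 1 / π / |w.im| := by
    rw [norm_neg, norm_div, norm_div, Complex.norm_real, Complex.norm_real,
      Real.norm_of_nonneg Real.pi_pos.le]
    gcongr
    · exact Real.abs_cos_le_one _
    · exact abs_im_le_norm_sub_ofReal w ξ
  rw [integral_sin_div_sub_eq_sub_integral hw hcos, add_div]
  exact (norm_add_le _ _).trans (add_le_add hboundary (norm_integral_cos_div_sub_sq_le hw hA))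

/-! ### Cauchy's formula on a strip -/

theorem integral_exp_neg_mul_abs {μ : ℝ} (hμ : 0 < μ) :
    ∫ x : ℝ, Real.exp (-(μ * |x|)) = 2 / μ := by
  have hhalf := integral_exp_mul_Ioi (neg_lt_zero.mpr hμ) 0
  simp only [neg_mul, mul_zero, Real.exp_zero, neg_div_neg_eq] at hhalf
  rw [integral_comp_abs (f := fun x => Real.exp (-(μ * x))), hhalf, mul_one_div]

theorem integrable_exp_neg_mul_abs {μ : ℝ} (hμ : 0 < μ) :
    Integrable fun x : ℝ => Real.exp (-(μ * |x|)) :=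
  Integrable.of_integral_ne_zero (by rw [integral_exp_neg_mul_abs hμ]; positivity)

theorem summable_exp_neg_mul_abs_int {μ : ℝ} (hμ : 0 < μ) :
    Summable fun k : ℤ => Real.exp (-(μ * |(k : ℝ)|)) := by
  have hnat : Summable fun n : ℕ => Real.exp (-(μ * n)) :=
    (Real.summable_exp_nat_mul_iff.mpr (neg_lt_zero.mpr hμ)).congr fun n => by ring_nf
  refine Summable.of_nat_of_neg ?_ ?_ <;> simpa using hnat

theorem ofReal_add_mul_I_mem_strip {d y : ℝ} (hy : |y| < d) (s : ℝ) :
    (s : ℂ) + y * I ∈ strip d := by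
  simpa [strip] using hy

theorem ofReal_mem_strip {d : ℝ} (hd : 0 < d) (x : ℝ) : (x : ℂ) ∈ strip d := by
  simpa [strip] using hd

theorem isOpen_strip (d : ℝ) : IsOpen (strip d) :=
  isOpen_lt (by fun_prop) continuous_const

theorem re_ofReal_add_mul_I (s y : ℝ) : ((s : ℂ) + y * I).re = s := by simp

theorem im_ofReal_add_mul_I (s y : ℝ) : ((s : ℂ) + y * I).im = y := by simp

theorem im_ofReal_add_mul_I_ne_zero {y : ℝ} (hy : y ≠ 0) (s : ℝ) : ((s : ℂ) + y * I).im ≠ 0 := by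
  rwa [im_ofReal_add_mul_I]

theorem continuous_comp_line {g : ℂ → ℂ} {d y : ℝ} (hg : DifferentiableOn ℂ g (strip d))
    (hy : |y| < d) : Continuous fun s : ℝ => g (s + y * I) :=
  hg.continuousOn.comp_continuous (by fun_prop) (ofReal_add_mul_I_mem_strip hy)

/-- A function is holomorphic in the strip `strip d` and decays exponentially there as
`|Re ζ| → ∞`, at the rate `μ > 0` and with the constant `B`. -/
structure StripDecay (g : ℂ → ℂ) (d B μ : ℝ) : Prop where
  differentiableOn : DifferentiableOn ℂ g (strip d)
  rate_pos : 0 < μ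
  norm_le : ∀ ζ ∈ strip d, ‖g ζ‖ ≤ B * Real.exp (-(μ * |ζ.re|))

namespace StripDecay

variable {g : ℂ → ℂ} {d B μ y : ℝ}

theorem norm_line_le (hg : StripDecay g d B μ) (hy : |y| < d) (s : ℝ) :
    ‖g (s + y * I)‖ ≤ B * Real.exp (-(μ * |s|)) := by
  simpa using hg.norm_le _ (ofReal_add_mul_I_mem_strip hy s)

theorem norm_ofReal_le (hg : StripDecay g d B μ) (hd : 0 < d) (x : ℝ) :
    ‖g x‖ ≤ B * Real.exp (-(μ * |x|)) := by
  simpa using hg.norm_le x (ofReal_mem_strip hd x)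

theorem bound_nonneg (hg : StripDecay g d B μ) (hd : 0 < d) : 0 ≤ B := by
  simpa using (norm_nonneg _).trans (hg.norm_ofReal_le hd 0)

theorem norm_le_bound (hg : StripDecay g d B μ) (hd : 0 < d) {ζ : ℂ} (hζ : ζ ∈ strip d) :
    ‖g ζ‖ ≤ B := by
  have hμ := hg.rate_pos
  refine (hg.norm_le ζ hζ).trans (mul_le_of_le_one_right (hg.bound_nonneg hd) ?_)
  exact Real.exp_le_one_iff.mpr (neg_nonpos.mpr (by positivity))

theorem summable_norm_int (hg : StripDecay g d B μ) (hd : 0 < d) :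
    Summable fun k : ℤ => ‖g k‖ :=
  Summable.of_nonneg_of_le (fun _ => norm_nonneg _)
    (fun k => by simpa using hg.norm_ofReal_le hd k)
    ((summable_exp_neg_mul_abs_int hg.rate_pos).mul_left B)

theorem continuous_line (hg : StripDecay g d B μ) (hy : |y| < d) :
    Continuous fun s : ℝ => g (s + y * I) :=
  continuous_comp_line hg.differentiableOn hy

theorem integrable_line (hg : StripDecay g d B μ) (hy : |y| < d) :
    Integrable fun s : ℝ => g (s + y * I) :=
  ((integrable_exp_neg_mul_abs hg.rate_pos).const_mul B).mono'
    (hg.continuous_line hy).aestronglyMeasurable (Eventually.of_forall (hg.norm_line_le hy))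

theorem integrable_ofReal (hg : StripDecay g d B μ) (hd : 0 < d) :
    Integrable fun x : ℝ => g x := by
  simpa using hg.integrable_line (y := 0) (by simpa using hd)

theorem integral_norm_line_le (hg : StripDecay g d B μ) (hy : |y| < d) :
    ∫ s : ℝ, ‖g (s + y * I)‖ ≤ 2 * B / μ := by
  calc _ ≤ ∫ s : ℝ, B * Real.exp (-(μ * |s|)) :=
        integral_mono (hg.integrable_line hy).norm
          ((integrable_exp_neg_mul_abs hg.rate_pos).const_mul B) (hg.norm_line_le hy)
    _ = 2 * B / μ := by
        rw [integral_const_mul, integral_exp_neg_mul_abs hg.rate_pos]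
        ring

theorem integrable_line_div_sub (hg : StripDecay g d B μ) (hy : |y| < d) (hy0 : y ≠ 0) (x : ℝ) :
    Integrable fun s : ℝ => g (s + y * I) / (s + y * I - x) := by
  have hne (s : ℝ) := sub_ofReal_ne_zero (im_ofReal_add_mul_I_ne_zero hy0 s) x
  refine ((hg.integrable_line hy).norm.mul_const |y|⁻¹).mono'
    ((hg.continuous_line hy).div (by fun_prop) hne).aestronglyMeasurable
    (Eventually.of_forall fun s => ?_)
  have := abs_pos.mpr hy0
  rw [norm_div, div_eq_mul_inv]
  gcongr
  simpa using abs_im_le_norm_sub_ofReal ((s : ℂ) + y * I) x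

end StripDecay

theorem abs_le_abs_of_mem_uIcc_neg {t y : ℝ} (ht : t ∈ uIcc (-y) y) : |t| ≤ |y| := by
  rcases mem_uIcc.mp ht with ⟨hl, hu⟩ | ⟨hl, hu⟩
  · exact abs_le_abs hu (by linarith)
  · rw [← abs_neg y]
    exact abs_le_abs hu (by linarith)

theorem integral_line_sub_integral_line_eq {F : ℂ → ℂ} {d y : ℝ}
    (hF : DifferentiableOn ℂ F (strip d)) (hy : |y| < d) (R : ℝ) :
    (∫ s in (-R)..R, F (s + (-y : ℝ) * I)) - (∫ s in (-R)..R, F (s + y * I)) =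
      I * (∫ t in (-y)..y, F ((-R : ℝ) + t * I)) - I * ∫ t in (-y)..y, F (R + t * I) := by
  have hrect := Complex.integral_boundary_rect_eq_zero_of_differentiableOn F ⟨-R, -y⟩ ⟨R, y⟩
    (hF.mono fun z hz => (abs_le_abs_of_mem_uIcc_neg hz.2).trans_lt hy)
  simp only [smul_eq_mul] at hrect
  linear_combination hrect

theorem tendsto_integral_line_sub_integral_line {F : ℂ → ℂ} {d y : ℝ}
    (hF : DifferentiableOn ℂ F (strip d)) (hy : |y| < d) {C : ℝ → ℝ}
    (hC : Tendsto C atTop (𝓝 0))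
    (hFC : ∀ᶠ R in atTop, ∀ ζ ∈ strip d, |ζ.re| = R → ‖F ζ‖ ≤ C R) :
    Tendsto (fun R : ℝ => (∫ s in (-R)..R, F (s + (-y : ℝ) * I)) -
      ∫ s in (-R)..R, F (s + y * I)) atTop (𝓝 0) := by
  have hvert (r : ℝ → ℝ) (hr : ∀ R, 0 < R → |r R| = R) :
      Tendsto (fun R : ℝ => ∫ t in (-y)..y, F (r R + t * I)) atTop (𝓝 0) := by
    have hlim : Tendsto (fun R => C R * |y - -y|) atTop (𝓝 0) := by
      simpa using hC.mul_const |y - -y|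
    refine squeeze_zero_norm' ?_ hlim
    filter_upwards [hFC, eventually_gt_atTop 0] with R hR hR0
    refine intervalIntegral.norm_integral_le_of_norm_le_const fun t ht => ?_
    have habs := abs_le_abs_of_mem_uIcc_neg (uIoc_subset_uIcc ht)
    exact hR _ (ofReal_add_mul_I_mem_strip (habs.trans_lt hy) _) (by simpa using hr R hR0)
  have hleft := hvert (fun R => -R) fun R hR => by rw [abs_neg, abs_of_pos hR]
  have hright := hvert (fun R => R) fun R hR => abs_of_pos hR
  simpa only [integral_line_sub_integral_line_eq hF hy, mul_zero, sub_zero] using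
    (hleft.const_mul I).sub (hright.const_mul I)

theorem norm_dslope_ofReal_le {g : ℂ → ℂ} {s : Set ℂ} {B : ℝ} (hg : ∀ ζ ∈ s, ‖g ζ‖ ≤ B)
    {x : ℝ} (hx : (x : ℂ) ∈ s) {ζ : ℂ} (hζ : ζ ∈ s) (hre : |x| < |ζ.re|) :
    ‖dslope g x ζ‖ ≤ 2 * B / (|ζ.re| - |x|) := by
  have hdist : |ζ.re| - |x| ≤ ‖ζ - x‖ :=
    (abs_sub_abs_le_abs_sub _ _).trans (by simpa using Complex.abs_re_le_norm (ζ - x))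
  have := sub_pos.mpr hre
  have hne : ζ ≠ x := fun h => by simp [h] at hre
  have hnum : ‖g ζ - g x‖ ≤ 2 * B := by
    linarith [norm_sub_le (g ζ) (g x), hg ζ hζ, hg x hx]
  rw [dslope_of_ne _ hne, slope_def_field, norm_div]
  gcongr
  exact (norm_nonneg _).trans hnum

theorem inv_sub_inv_line_eq {y : ℝ} (hy : y ≠ 0) (x s : ℝ) :
    1 / ((s : ℂ) + (-y : ℝ) * I - x) - 1 / (s + y * I - x) =
      2 * y * I * ((((s - x) ^ 2 + y ^ 2)⁻¹ : ℝ) : ℂ) := by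
  have hlower := sub_ofReal_ne_zero (im_ofReal_add_mul_I_ne_zero (neg_ne_zero.mpr hy) s) x
  have hupper := sub_ofReal_ne_zero (im_ofReal_add_mul_I_ne_zero hy s) x
  have hprod : ((s : ℂ) + (-y : ℝ) * I - x) * (s + y * I - x) =
      (((s - x) ^ 2 + y ^ 2 : ℝ) : ℂ) := by
    push_cast
    linear_combination (-(y : ℂ) ^ 2) * Complex.I_sq
  rw [div_sub_div _ _ hlower hupper, hprod]
  push_cast
  rw [div_eq_mul_inv]
  ring

theorem integrable_inv_sub_inv_line {y : ℝ} (hy : y ≠ 0) (x : ℝ) :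
    Integrable fun s : ℝ => 1 / ((s : ℂ) + (-y : ℝ) * I - x) - 1 / (s + y * I - x) :=
  ((integrable_inv_sub_sq_add_sq hy x).ofReal.const_mul _).congr
    (Eventually.of_forall fun s => (inv_sub_inv_line_eq hy x s).symm)

theorem integral_inv_sub_inv_line {y : ℝ} (hy : 0 < y) (x : ℝ) :
    ∫ s : ℝ, (1 / ((s : ℂ) + (-y : ℝ) * I - x) - 1 / (s + y * I - x)) = 2 * π * I := by
  have hy' : (y : ℂ) ≠ 0 := by exact_mod_cast hy.ne'
  simp only [inv_sub_inv_line_eq hy.ne']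
  rw [integral_const_mul, integral_complex_ofReal, integral_univ_inv_sub_sq_add_sq hy.ne',
    abs_of_pos hy]
  push_cast
  field_simp

/-- The Cauchy integral of `g` along the line `Im ζ = y`, evaluated at the real point `x`. -/
def lineCauchyIntegral (g : ℂ → ℂ) (y x : ℝ) : ℂ :=
  ∫ s : ℝ, g (s + y * I) / (s + y * I - x)

namespace StripDecay

variable {g : ℂ → ℂ} {d B μ y : ℝ}

theorem tendsto_integral_dslope_line_sub (hg : StripDecay g d B μ) (hd : 0 < d) (hy : |y| < d)
    (x : ℝ) :
    Tendsto (fun R : ℝ => (∫ s in (-R)..R, dslope g x (s + (-y : ℝ) * I)) -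
      ∫ s in (-R)..R, dslope g x (s + y * I)) atTop (𝓝 0) := by
  have hx := ofReal_mem_strip hd x
  have hC : Tendsto (fun R : ℝ => 2 * B / (R - |x|)) atTop (𝓝 0) :=
    (tendsto_atTop_add_const_right _ _ tendsto_id).const_div_atTop _
  refine tendsto_integral_line_sub_integral_line
    ((Complex.differentiableOn_dslope ((isOpen_strip d).mem_nhds hx)).mpr hg.differentiableOn)
    hy hC ?_
  filter_upwards [eventually_gt_atTop |x|] with R hR ζ hζ hre
  simpa only [hre] using
    norm_dslope_ofReal_le (fun _ => hg.norm_le_bound hd) hx hζ (hre ▸ hR)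

theorem lineCauchyIntegral_sub (hg : StripDecay g d B μ) (hy0 : 0 < y) (hy : y < d) (x : ℝ) :
    lineCauchyIntegral g (-y) x - lineCauchyIntegral g y x = 2 * π * I * g x := by
  have hd := hy0.trans hy
  have hupper : |y| < d := by rwa [abs_of_pos hy0]
  have hlower : |-y| < d := by rwa [abs_neg]
  have hF := (Complex.differentiableOn_dslope
    ((isOpen_strip d).mem_nhds (ofReal_mem_strip hd x))).mpr hg.differentiableOn
  have hgl := hg.integrable_line_div_sub hlower (neg_ne_zero.mpr hy0.ne') x
  have hgu := hg.integrable_line_div_sub hupper hy0.ne' x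
  have hker := (integrable_inv_sub_inv_line hy0.ne' x).const_mul (g x)
  have hdiff : Integrable fun s : ℝ => g (s + (-y : ℝ) * I) / (s + (-y : ℝ) * I - x) -
    g (s + y * I) / (s + y * I - x) := hgl.sub hgu
  have hlim := intervalIntegral_tendsto_integral (hdiff.sub hker)
    tendsto_neg_atTop_atBot tendsto_id
  have hslope {v : ℝ} (hv : v ≠ 0) (s : ℝ) :
      dslope g x (s + v * I) = (g (s + v * I) - g x) / (s + v * I - x) := by
    have hne := sub_ofReal_ne_zero (im_ofReal_add_mul_I_ne_zero hv s) x
    rw [dslope_of_ne _ (sub_ne_zero.mp hne), slope_def_field]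
  have hzero : ∫ s : ℝ, (g (s + (-y : ℝ) * I) / (s + (-y : ℝ) * I - x) -
      g (s + y * I) / (s + y * I - x) -
      g x * (1 / ((s : ℂ) + (-y : ℝ) * I - x) - 1 / (s + y * I - x))) = 0 := by
    refine tendsto_nhds_unique
      (hlim.congr fun R => ?_) (hg.tendsto_integral_dslope_line_sub hd hupper x)
    rw [← intervalIntegral.integral_sub ((continuous_comp_line hF hlower).intervalIntegrable _ _)
      ((continuous_comp_line hF hupper).intervalIntegrable _ _)]
    refine intervalIntegral.integral_congr fun s _ => ?_
    simp only [Pi.sub_apply, hslope hy0.ne', hslope (neg_ne_zero.mpr hy0.ne')]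
    ring
  rw [integral_sub hdiff hker, integral_sub hgl hgu, integral_const_mul,
    integral_inv_sub_inv_line hy0] at hzero
  unfold lineCauchyIntegral
  linear_combination hzero

end StripDecay

/-! ### The remainder of the cardinal series -/

theorem norm_div_sin_pi_mul_le (a : ℂ) {w : ℂ} (hw : w.im ≠ 0) :
    ‖a / Complex.sin (π * w)‖ ≤ ‖a‖ / Real.sinh (π * |w.im|) := by
  have := Real.sinh_pos_iff.mpr (mul_pos Real.pi_pos (abs_pos.mpr hw))
  rw [norm_div]
  gcongr
  exact sinh_pi_mul_abs_im_le_norm_sin w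

theorem norm_sin_div_sub_le {w : ℂ} (hw : w.im ≠ 0) (x : ℝ) :
    ‖(Real.sin (π * x) : ℂ) / (w - x)‖ ≤ 1 / |w.im| := by
  have := abs_pos.mpr hw
  rw [norm_div, Complex.norm_real]
  gcongr
  · exact Real.abs_sin_le_one _
  · exact abs_im_le_norm_sub_ofReal w x

/-- The integrand, at the point `s + i y`, of the contour integral which represents the remainder
of the cardinal series of `g` at `x`. -/
def remainderKernel (g : ℂ → ℂ) (y x s : ℝ) : ℂ :=
  g (s + y * I) / Complex.sin (π * (s + y * I)) * (Real.sin (π * x) / (s + y * I - x))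

/-- The contribution of the line `Im ζ = y` to the remainder of the cardinal series of `g`
at `x`. -/
def lineRemainder (g : ℂ → ℂ) (y x : ℝ) : ℂ :=
  ∫ s : ℝ, remainderKernel g y x s

theorem norm_remainderKernel_le (g : ℂ → ℂ) {y : ℝ} (hy : y ≠ 0) (x s : ℝ) :
    ‖remainderKernel g y x s‖ ≤ (Real.sinh (π * |y|))⁻¹ * |y|⁻¹ * ‖g (s + y * I)‖ := by
  have hw := im_ofReal_add_mul_I_ne_zero hy s
  have hsin := norm_div_sin_pi_mul_le (g (s + y * I)) hw
  have hsub := norm_sin_div_sub_le hw x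
  rw [im_ofReal_add_mul_I] at hsin hsub
  calc ‖remainderKernel g y x s‖
      ≤ ‖g (s + y * I)‖ / Real.sinh (π * |y|) * (1 / |y|) := by
        rw [remainderKernel, norm_mul]
        gcongr
    _ = _ := by ring

theorem continuous_remainderKernel {g : ℂ → ℂ} {y : ℝ}
    (hg : Continuous fun s : ℝ => g (s + y * I)) (hy : y ≠ 0) :
    Continuous (Function.uncurry (remainderKernel g y)) := by
  have hline : Continuous fun p : ℝ × ℝ => g ((p.2 : ℂ) + y * I) := hg.comp continuous_snd
  have him (p : ℝ × ℝ) := im_ofReal_add_mul_I_ne_zero hy p.2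
  exact (hline.div (by fun_prop) fun p => sin_pi_mul_ne_zero_of_im_ne_zero (him p)).mul
    (Continuous.div (by fun_prop) (by fun_prop) fun p => sub_ofReal_ne_zero (him p) p.1)

theorem hasDerivAt_sincJ_one (k : ℤ) (x : ℝ) :
    HasDerivAt (sincJ k 1) (Real.sinc (π * (x - k))) x := by
  have harg : HasDerivAt (fun x : ℝ => π * (x / 1 - k)) π x := by
    simpa using (((hasDerivAt_id x).div_const 1).sub_const (k : ℝ)).const_mul π
  convert! ((((hasDerivAt_sineIntegral _).comp x harg).const_mul (1 / π)).const_add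
    (1 / 2)).const_mul 1 using 1
  field_simp

theorem integral_sinc_eq_sincJ_sub (k : ℤ) (A ξ : ℝ) :
    ∫ x in A..ξ, Real.sinc (π * (x - k)) = sincJ k 1 ξ - sincJ k 1 A :=
  intervalIntegral.integral_eq_sub_of_hasDerivAt (fun x _ => hasDerivAt_sincJ_one k x)
    ((Real.continuous_sinc.comp (by fun_prop)).intervalIntegrable _ _)

theorem sincJ_one_neg_half_integer (k : ℤ) {m : ℕ} (hm : k.natAbs ≤ m) :
    sincJ k 1 (-(m + 1 / 2)) =
      1 / 2 - 1 / π * sineIntegral (π * (((m + k).toNat : ℕ) + 1 / 2)) := by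
  have hcast : (((m + k).toNat : ℕ) : ℝ) = m + k := by
    have hint : ((m + k).toNat : ℤ) = m + k := Int.toNat_of_nonneg (by omega)
    exact_mod_cast hint
  have harg : π * (-((m : ℝ) + 1 / 2) / 1 - k) = -(π * (m + k + 1 / 2)) := by ring
  rw [sincJ, harg, sineIntegral_neg, hcast]
  ring

theorem tendsto_sincJ_neg_half_integer (k : ℤ) :
    Tendsto (fun m : ℕ => sincJ k 1 (-((m : ℝ) + 1 / 2))) atTop (𝓝 0) := by
  have hshift : Tendsto (fun m : ℕ => ((m : ℤ) + k).toNat) atTop atTop := by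
    refine tendsto_atTop.mpr fun b => ?_
    filter_upwards [eventually_ge_atTop (b + k.natAbs)] with m hm
    omega
  have hlim := ((tendsto_sineIntegral_half_integer.comp hshift).const_mul (1 / π)).const_sub (1 / 2)
  have hzero : 1 / 2 - 1 / π * (π / 2) = 0 := by
    field_simp
    ring
  rw [hzero] at hlim
  refine hlim.congr' ?_
  filter_upwards [eventually_ge_atTop k.natAbs] with m hm
  exact (sincJ_one_neg_half_integer k hm).symm

namespace StripDecay

variable {g : ℂ → ℂ} {d B μ y : ℝ}

theorem integrable_one_add_abs_mul_norm_line (hg : StripDecay g d B μ) (hy : |y| < d) :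
    Integrable fun s : ℝ => (1 + |s|) * ‖g (s + y * I)‖ := by
  have hμ := hg.rate_pos
  have := hg.bound_nonneg ((abs_nonneg y).trans_lt hy)
  refine ((integrable_exp_neg_mul_abs (half_pos hμ)).const_mul ((1 + 2 / μ) * B)).mono'
    (Continuous.aestronglyMeasurable ?_) (Eventually.of_forall fun s => ?_)
  · exact (by fun_prop : Continuous fun s : ℝ => 1 + |s|).mul (hg.continuous_line hy).norm
  have hsplit : Real.exp (-(μ * |s|)) = (Real.exp (μ / 2 * |s|))⁻¹ * Real.exp (-(μ / 2 * |s|)) := by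
    rw [← Real.exp_neg, ← Real.exp_add]
    ring_nf
  have hexp : 1 + |s| ≤ (1 + 2 / μ) * Real.exp (μ / 2 * |s|) := by
    have hone : 1 ≤ Real.exp (μ / 2 * |s|) := Real.one_le_exp (by positivity)
    have hlin : μ / 2 * |s| ≤ Real.exp (μ / 2 * |s|) := by
      linarith [Real.add_one_le_exp (μ / 2 * |s|)]
    calc 1 + |s| = 1 + 2 / μ * (μ / 2 * |s|) := by field_simp
      _ ≤ Real.exp (μ / 2 * |s|) + 2 / μ * Real.exp (μ / 2 * |s|) := by gcongr
      _ = _ := by ring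
  rw [Real.norm_of_nonneg (by positivity)]
  calc (1 + |s|) * ‖g (s + y * I)‖
      ≤ ((1 + 2 / μ) * Real.exp (μ / 2 * |s|)) *
          (B * ((Real.exp (μ / 2 * |s|))⁻¹ * Real.exp (-(μ / 2 * |s|)))) := by
        rw [← hsplit]
        gcongr
        exact hg.norm_line_le hy s
    _ = _ := by
        have := (Real.exp_pos (μ / 2 * |s|)).ne'
        field_simp

theorem integrable_remainderKernel (hg : StripDecay g d B μ) (hy : |y| < d) (hy0 : y ≠ 0)
    (x : ℝ) : Integrable (remainderKernel g y x) :=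
  ((hg.integrable_line hy).norm.const_mul _).mono'
    (((continuous_remainderKernel (hg.continuous_line hy) hy0).comp
      (Continuous.prodMk_right x)).aestronglyMeasurable)
    (Eventually.of_forall (norm_remainderKernel_le g hy0 x))

theorem hasSum_lineCauchyIntegral_mul_sinc (hg : StripDecay g d B μ) (hy : |y| < d)
    (hy0 : y ≠ 0) (x : ℝ) :
    HasSum (fun k : ℤ => lineCauchyIntegral g y k * (Real.sinc (π * (x - k)) : ℂ))
      (lineCauchyIntegral g y x - lineRemainder g y x) := by
  have him := im_ofReal_add_mul_I_ne_zero hy0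
  have hdiv := hg.integrable_line_div_sub hy hy0
  have hterm (k : ℤ) : Integrable fun s : ℝ =>
      g (s + y * I) * ((Real.sinc (π * (x - k)) : ℂ) / (s + y * I - k)) :=
    ((hdiv k).mul_const (Real.sinc (π * (x - k)) : ℂ)).congr
      (Eventually.of_forall fun s => by push_cast; ring)
  have hbound (k : ℤ) (s : ℝ) :
      ‖g (s + y * I) * ((Real.sinc (π * (x - k)) : ℂ) / (s + y * I - k))‖ ≤
        (1 / (1 + |(k : ℝ)|)) ^ 2 *
          ((2 + |x|) * (1 / |y| + 1) * ((1 + |s|) * ‖g (s + y * I)‖)) := by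
    have hsinc := norm_sinc_div_sub_int_le x (him s) k
    rw [re_ofReal_add_mul_I, im_ofReal_add_mul_I] at hsinc
    rw [norm_mul]
    exact (mul_le_mul_of_nonneg_left hsinc (norm_nonneg _)).trans_eq (by ring)
  have hmaj := (hg.integrable_one_add_abs_mul_norm_line hy).const_mul ((2 + |x|) * (1 / |y| + 1))
  have hsummable : Summable fun k : ℤ =>
      ∫ s : ℝ, ‖g (s + y * I) * ((Real.sinc (π * (x - k)) : ℂ) / (s + y * I - k))‖ := by
    refine Summable.of_nonneg_of_le (fun k => by positivity)
      (fun k => integral_mono (hterm k).norm (hmaj.const_mul _) (hbound k)) ?_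
    simp_rw [integral_const_mul]
    exact summable_inv_one_add_abs_sq.mul_right _
  have hpointwise (s : ℝ) :
      ∑' k : ℤ, g (s + y * I) * ((Real.sinc (π * (x - k)) : ℂ) / (s + y * I - k)) =
        g (s + y * I) / (s + y * I - x) - remainderKernel g y x s := by
    rw [((hasSum_sinc_div_sub_int x (him s)).mul_left _).tsum_eq, remainderKernel]
    push_cast
    ring
  have hsum := hasSum_integral_of_summable_integral_norm hterm hsummable
  simp_rw [hpointwise] at hsum
  rw [integral_sub (hdiv x) (hg.integrable_remainderKernel hy hy0 x)] at hsum
  refine hsum.congr_fun fun k => ?_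
  rw [lineCauchyIntegral, ← integral_mul_const]
  congr with s
  push_cast
  ring

-- The contour integral over the boundary of the strip, from Cauchy's formula and the
-- interpolation of the Cauchy kernel.
theorem hasSum_cardinalSeries (hg : StripDecay g d B μ) (hy0 : 0 < y) (hy : y < d) (x : ℝ) :
    HasSum (fun k : ℤ => g k * (Real.sinc (π * (x - k)) : ℂ))
      (g x - (2 * π * I)⁻¹ * (lineRemainder g (-y) x - lineRemainder g y x)) := by
  have hpi : (2 * π * I : ℂ) ≠ 0 := by simp [Real.pi_ne_zero]
  have hcauchy (t : ℝ) :
      (2 * π * I)⁻¹ * (lineCauchyIntegral g (-y) t - lineCauchyIntegral g y t) = g t := by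
    rw [hg.lineCauchyIntegral_sub hy0 hy, inv_mul_cancel_left₀ hpi]
  have hlower := hg.hasSum_lineCauchyIntegral_mul_sinc (y := -y)
    (by rwa [abs_neg, abs_of_pos hy0]) (neg_ne_zero.mpr hy0.ne') x
  have hupper := hg.hasSum_lineCauchyIntegral_mul_sinc (by rwa [abs_of_pos hy0]) hy0.ne' x
  convert! (hlower.sub hupper).mul_left (2 * π * I)⁻¹ using 1
  · ext k
    rw [← Complex.ofReal_intCast k, ← hcauchy k]
    ring
  · rw [← hcauchy x]
    ring

theorem integrable_prod_remainderKernel (hg : StripDecay g d B μ) (hy : |y| < d) (hy0 : y ≠ 0)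
    (A ξ : ℝ) : Integrable (Function.uncurry (remainderKernel g y))
      ((volume.restrict (uIoc A ξ)).prod volume) := by
  have : IsFiniteMeasure (volume.restrict (uIoc A ξ)) := ⟨by simp [uIoc]⟩
  exact ((integrable_const _).mul_prod (hg.integrable_line hy).norm).mono'
    (continuous_remainderKernel (hg.continuous_line hy) hy0).aestronglyMeasurable
    (Eventually.of_forall fun p => norm_remainderKernel_le g hy0 p.1 p.2)

theorem intervalIntegrable_lineRemainder (hg : StripDecay g d B μ) (hy : |y| < d) (hy0 : y ≠ 0)
    (A ξ : ℝ) : IntervalIntegrable (lineRemainder g y) volume A ξ :=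
  intervalIntegrable_iff.mpr (hg.integrable_prod_remainderKernel hy hy0 A ξ).integral_prod_left

theorem norm_integral_lineRemainder_le (hg : StripDecay g d B μ) (hy : |y| < d) (hy0 : y ≠ 0)
    {A ξ : ℝ} (hA : A ≤ ξ) (hcos : Real.cos (π * A) = 0) :
    ‖∫ x in A..ξ, lineRemainder g y x‖ ≤
      2 * B / μ * ((1 / π + 1) / |y| / Real.sinh (π * |y|)) := by
  have := abs_pos.mpr hy0
  have := Real.sinh_pos_iff.mpr (mul_pos Real.pi_pos (abs_pos.mpr hy0))
  have hinner (s : ℝ) : ‖∫ x in A..ξ, remainderKernel g y x s‖ ≤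
      ‖g (s + y * I)‖ * ((1 / π + 1) / |y| / Real.sinh (π * |y|)) := by
    have hw := im_ofReal_add_mul_I_ne_zero hy0 s
    have hsin := norm_div_sin_pi_mul_le (g (s + y * I)) hw
    have hparts := norm_integral_sin_div_sub_le hw hA hcos
    rw [im_ofReal_add_mul_I] at hsin hparts
    simp only [remainderKernel, intervalIntegral.integral_const_mul, norm_mul]
    exact (mul_le_mul hsin hparts (norm_nonneg _) (by positivity)).trans_eq (by ring)
  unfold lineRemainder
  rw [intervalIntegral_integral_swap (hg.integrable_prod_remainderKernel hy hy0 A ξ)]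
  calc _ ≤ ∫ s : ℝ, ‖g (s + y * I)‖ * ((1 / π + 1) / |y| / Real.sinh (π * |y|)) :=
        norm_integral_le_of_norm_le ((hg.integrable_line hy).norm.mul_const _)
          (Eventually.of_forall hinner)
    _ ≤ _ := by
        rw [integral_mul_const]
        gcongr
        exact hg.integral_norm_line_le hy

theorem hasSum_integral_sinc (hg : StripDecay g d B μ) (hy0 : 0 < y) (hy : y < d) (A ξ : ℝ) :
    HasSum (fun k : ℤ => g k * ((sincJ k 1 ξ : ℂ) - sincJ k 1 A))
      (∫ x in A..ξ,
        (g x - (2 * π * I)⁻¹ * (lineRemainder g (-y) x - lineRemainder g y x))) := by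
  have hterm (k : ℤ) : ∫ x in A..ξ, g k * (Real.sinc (π * (x - k)) : ℂ) =
      g k * ((sincJ k 1 ξ : ℂ) - sincJ k 1 A) := by
    rw [intervalIntegral.integral_const_mul, intervalIntegral.integral_ofReal,
      integral_sinc_eq_sincJ_sub, Complex.ofReal_sub]
  have hcont (k : ℤ) : Continuous fun x : ℝ => g k * (Real.sinc (π * (x - k)) : ℂ) :=
    continuous_const.mul (Complex.continuous_ofReal.comp
      (Real.continuous_sinc.comp (by fun_prop)))
  simpa only [hterm] using intervalIntegral.hasSum_integral_of_dominated_convergence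
    (μ := volume) (a := A) (b := ξ) (fun (k : ℤ) _ => ‖g k‖)
    (fun k => (hcont k).aestronglyMeasurable)
    (fun k => Eventually.of_forall fun x _ => by
      rw [norm_mul, Complex.norm_real]
      exact mul_le_of_le_one_right (norm_nonneg _) (Real.abs_sinc_le_one _))
    (Eventually.of_forall fun _ _ => hg.summable_norm_int (hy0.trans hy))
    intervalIntegrable_const
    (Eventually.of_forall fun x _ => hg.hasSum_cardinalSeries hy0 hy x)

theorem norm_integral_sub_tsum_sincJ_sub_le (hg : StripDecay g d B μ) (hy0 : 0 < y) (hy : y < d)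
    {A ξ : ℝ} (hA : A ≤ ξ) (hcos : Real.cos (π * A) = 0) :
    ‖(∫ x in A..ξ, g x) - ∑' k : ℤ, g k * ((sincJ k 1 ξ : ℂ) - sincJ k 1 A)‖ ≤
      2 * B / μ * ((1 / π + 1) / y / Real.sinh (π * y)) / π := by
  have hupper : |y| < d := by rwa [abs_of_pos hy0]
  have hlower : |-y| < d := by rwa [abs_neg]
  have hy0' := neg_ne_zero.mpr hy0.ne'
  have hil := hg.intervalIntegrable_lineRemainder hlower hy0' A ξ
  have hiu := hg.intervalIntegrable_lineRemainder hupper hy0.ne' A ξ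
  have hnl := hg.norm_integral_lineRemainder_le hlower hy0' hA hcos
  have hnu := hg.norm_integral_lineRemainder_le hupper hy0.ne' hA hcos
  rw [abs_neg, abs_of_pos hy0] at hnl
  rw [abs_of_pos hy0] at hnu
  have hseries := (hg.hasSum_integral_sinc hy0 hy A ξ).tsum_eq
  have hgi := (hg.integrable_ofReal (hy0.trans hy)).intervalIntegrable (a := A) (b := ξ)
  have hpi : ‖(2 * π * I : ℂ)‖ = 2 * π := by simp [abs_of_pos Real.pi_pos]
  rw [hseries, intervalIntegral.integral_sub hgi ((hil.sub hiu).const_mul _), sub_sub_cancel,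
    intervalIntegral.integral_const_mul, intervalIntegral.integral_sub hil hiu, norm_mul, norm_inv,
    hpi]
  calc _ ≤ (2 * π)⁻¹ * (2 * B / μ * ((1 / π + 1) / y / Real.sinh (π * y)) +
        2 * B / μ * ((1 / π + 1) / y / Real.sinh (π * y))) := by
        gcongr
        exact (norm_sub_le _ _).trans (add_le_add hnl hnu)
    _ = _ := by
        field_simp
        ring

-- The lower limits `-(m + 1 / 2)` are zeros of `cos (π x)`, so integrating by parts leaves no
-- boundary term there.
theorem norm_integral_Iic_sub_tsum_sincJ_le_of_lt (hg : StripDecay g d B μ) (hy0 : 0 < y)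
    (hy : y < d) (ξ : ℝ) :
    ‖(∫ x in Iic ξ, g x) - ∑' k : ℤ, g k * (sincJ k 1 ξ : ℂ)‖ ≤
      2 * B / μ * ((1 / π + 1) / y / Real.sinh (π * y)) / π := by
  have hd := hy0.trans hy
  have hA : Tendsto (fun m : ℕ => -((m : ℝ) + 1 / 2)) atTop atBot :=
    tendsto_neg_atTop_atBot.comp
      (tendsto_atTop_add_const_right _ _ tendsto_natCast_atTop_atTop)
  have hint := intervalIntegral_tendsto_integral_Iic ξ (hg.integrable_ofReal hd).integrableOn hA
  have hJ (k : ℤ) (x : ℝ) : ‖(sincJ k 1 x : ℂ)‖ ≤ 1.1 := by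
    simpa only [Complex.norm_real, Real.norm_eq_abs, mul_one] using abs_sincJ_le zero_le_one k x
  have hsum : Tendsto (fun m : ℕ => ∑' k : ℤ, g k *
      ((sincJ k 1 ξ : ℂ) - sincJ k 1 (-((m : ℝ) + 1 / 2)))) atTop
      (𝓝 (∑' k : ℤ, g k * (sincJ k 1 ξ : ℂ))) := by
    refine tendsto_tsum_of_dominated_convergence
      ((hg.summable_norm_int hd).mul_right (1.1 + 1.1)) (fun k => ?_)
      (Eventually.of_forall fun m k => ?_)
    · have hk := (Complex.continuous_ofReal.tendsto 0).comp (tendsto_sincJ_neg_half_integer k)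
      simpa using (hk.const_sub (sincJ k 1 ξ : ℂ)).const_mul (g k)
    · rw [norm_mul]
      gcongr
      exact (norm_sub_le _ _).trans (add_le_add (hJ k _) (hJ k _))
  refine le_of_tendsto (hint.sub hsum).norm ?_
  filter_upwards [hA.eventually (eventually_le_atBot ξ)] with m hm
  refine hg.norm_integral_sub_tsum_sincJ_sub_le hy0 hy hm ?_
  rw [Real.cos_eq_zero_iff]
  exact ⟨-(m : ℤ) - 1, by push_cast; ring⟩

theorem norm_integral_Iic_sub_tsum_sincJ_le_div_sinh (hg : StripDecay g d B μ) (hd : 0 < d)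
    (ξ : ℝ) :
    ‖(∫ x in Iic ξ, g x) - ∑' k : ℤ, g k * (sincJ k 1 ξ : ℂ)‖ ≤
      B / (μ * d * Real.sinh (π * d)) := by
  have hμ := hg.rate_pos
  have hB := hg.bound_nonneg hd
  have hsinh : 0 < Real.sinh (π * d) := Real.sinh_pos_iff.mpr (by positivity)
  have hlim : Tendsto (fun y => 2 * B / μ * ((1 / π + 1) / y / Real.sinh (π * y)) / π) (𝓝[<] d)
      (𝓝 (2 * B / μ * ((1 / π + 1) / d / Real.sinh (π * d)) / π)) := by
    refine tendsto_nhdsWithin_of_tendsto_nhds (ContinuousAt.tendsto ?_)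
    have hcont : ContinuousAt (fun y => Real.sinh (π * y)) d := by fun_prop
    exact (continuousAt_const.mul ((continuousAt_const.div continuousAt_id hd.ne').div hcont
      hsinh.ne')).div_const _
  have hpi : (1 / π + 1) / π ≤ 1 / 2 := by
    rw [div_add_one Real.pi_ne_zero, div_div, div_le_div_iff₀ (by positivity) two_pos]
    nlinarith [Real.pi_gt_three]
  calc _ ≤ 2 * B / μ * ((1 / π + 1) / d / Real.sinh (π * d)) / π := by
        refine ge_of_tendsto hlim ?_
        filter_upwards [Ioo_mem_nhdsLT hd] with y hy
        exact hg.norm_integral_Iic_sub_tsum_sincJ_le_of_lt hy.1 hy.2 ξ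
    _ = 2 * B / (μ * d * Real.sinh (π * d)) * ((1 / π + 1) / π) := by field_simp
    _ ≤ 2 * B / (μ * d * Real.sinh (π * d)) * (1 / 2) := by gcongr
    _ = B / (μ * d * Real.sinh (π * d)) := by ring

theorem comp_mul_ofReal (hg : StripDecay g d B μ) {h : ℝ} (hh : 0 < h) :
    StripDecay (fun ζ => g (ζ * h)) (d / h) B (μ * h) := by
  have hmap (ζ : ℂ) (hζ : ζ ∈ strip (d / h)) : ζ * h ∈ strip d := by
    simp only [strip, mem_ofPred_eq] at hζ ⊢
    rwa [Complex.im_mul_ofReal, abs_mul, abs_of_pos hh, ← lt_div_iff₀ hh]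
  refine ⟨hg.differentiableOn.comp (by fun_prop) hmap, mul_pos hg.rate_pos hh, fun ζ hζ => ?_⟩
  have hle := hg.norm_le _ (hmap ζ hζ)
  rwa [Complex.re_mul_ofReal, abs_mul, abs_of_pos hh, mul_comm |ζ.re|, ← mul_assoc] at hle

end StripDecay

theorem integral_comp_mul_right_Iic {E : Type*} [NormedAddCommGroup E] [NormedSpace ℝ E]
    (f : ℝ → E) (a : ℝ) {b : ℝ} (hb : 0 < b) :
    ∫ x in Iic a, f (x * b) = b⁻¹ • ∫ x in Iic (a * b), f x := by
  have hleft := integral_comp_neg_Iic a fun x => f (-(x * b))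
  have hright := integral_comp_neg_Iic (a * b) fun x => f (-x)
  simp only [neg_mul, neg_neg] at hleft hright
  rw [hleft, hright, integral_comp_mul_right_Ioi (fun x => f (-x)) (-a) hb, neg_mul]

theorem sincJ_eq_mul_sincJ_one (k : ℤ) (h x : ℝ) : sincJ k h x = h * sincJ k 1 (x / h) := by
  simp only [sincJ, div_one, one_mul]

theorem inv_two_mul_sinh (u : ℝ) :
    (2 * Real.sinh u)⁻¹ = Real.exp (-u) / (1 - Real.exp (-(2 * u))) := by
  have hu := (Real.exp_pos (-u)).ne'
  have hden : 1 - Real.exp (-(2 * u)) = Real.exp (-u) * (2 * Real.sinh u) := by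
    rw [Real.sinh_eq, mul_div_cancel₀ _ two_ne_zero, mul_sub, ← Real.exp_add, ← Real.exp_add,
      neg_add_cancel, Real.exp_zero, two_mul, neg_add]
  rw [hden, div_mul_cancel_left₀ hu]

theorem StripDecay.norm_integral_Iic_sub_tsum_sincJ_le {g : ℂ → ℂ} {d B μ : ℝ}
    (hg : StripDecay g d B μ) (hd : 0 < d) {h : ℝ} (hh : 0 < h) (ξ : ℝ) :
    ‖(∫ x in Iic ξ, g x) - ∑' k : ℤ, g (k * h : ℝ) * (sincJ k h ξ : ℂ)‖ ≤
      2 * B * h / (μ * d) *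
        (Real.exp (-(π * d / h)) / (1 - Real.exp (-(2 * (π * d / h))))) := by
  have hh' : (h : ℂ) ≠ 0 := by exact_mod_cast hh.ne'
  have hunit := (hg.comp_mul_ofReal hh).norm_integral_Iic_sub_tsum_sincJ_le_div_sinh
    (div_pos hd hh) (ξ / h)
  have hint : ∫ x in Iic ξ, g x = h * ∫ x in Iic (ξ / h), g (x * h) := by
    have hscale := integral_comp_mul_right_Iic (fun x : ℝ => g x) (ξ / h) hh
    rw [div_mul_cancel₀ _ hh.ne', Complex.real_smul] at hscale
    push_cast at hscale
    rw [hscale, mul_inv_cancel_left₀ hh']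
  have hsum : ∑' k : ℤ, g (k * h : ℝ) * (sincJ k h ξ : ℂ) =
      h * ∑' k : ℤ, g (k * h) * (sincJ k 1 (ξ / h) : ℂ) := by
    rw [← tsum_mul_left]
    refine tsum_congr fun k => ?_
    rw [sincJ_eq_mul_sincJ_one]
    push_cast
    ring
  rw [hint, hsum, ← mul_sub, norm_mul, Complex.norm_real, Real.norm_of_nonneg hh.le]
  refine (mul_le_mul_of_nonneg_left hunit hh.le).trans_eq ?_
  rw [← inv_two_mul_sinh, mul_div_assoc π]
  field_simp

/-! ### Truncation and choice of the mesh -/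

theorem hasSum_indicator_Ioi_exp_neg_mul (N : ℤ) {c : ℝ} (hc : 0 < c) :
    HasSum ((Ioi N).indicator fun k : ℤ => Real.exp (-(c * k)))
      (Real.exp (-(c * N)) / (Real.exp c - 1)) := by
  have hinj : Function.Injective fun j : ℕ => N + 1 + j := fun a b hab => by simpa using hab
  have hsub : Real.exp c - 1 ≠ 0 := (sub_pos.mpr (Real.one_lt_exp_iff.mpr hc)).ne'
  have hvalue : Real.exp (-(c * (N + 1))) * (1 - Real.exp (-c))⁻¹ =
      Real.exp (-(c * N)) / (Real.exp c - 1) := by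
    have hden : 1 - Real.exp (-c) = Real.exp (-c) * (Real.exp c - 1) := by
      rw [mul_sub, ← Real.exp_add, neg_add_cancel, Real.exp_zero, mul_one]
    rw [hden, mul_add_one, neg_add, Real.exp_add]
    field_simp
  have hgeom := (hasSum_geometric_of_lt_one (Real.exp_pos (-c)).le
    (Real.exp_lt_one_iff.mpr (neg_lt_zero.mpr hc))).mul_left (Real.exp (-(c * (N + 1))))
  rw [hvalue] at hgeom
  refine (hinj.hasSum_iff fun k hk => indicator_of_notMem (fun hNk => hk ?_) _).mp
    (hgeom.congr_fun fun j => ?_)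
  · rw [mem_Ioi] at hNk
    exact ⟨(k - (N + 1)).toNat, by simp only; omega⟩
  · have hmem : N + 1 + (j : ℤ) ∈ Ioi N := by
      rw [mem_Ioi]
      omega
    rw [Function.comp_apply, indicator_of_mem hmem, ← Real.exp_nat_mul, ← Real.exp_add]
    push_cast
    ring_nf

theorem norm_tsum_sub_sum_Icc_le {E : Type*} [NormedAddCommGroup E] [CompleteSpace E] {a : ℤ → E}
    (ha : Summable a) {C p q : ℝ} (hp : 0 < p) (hq : 0 < q)
    (hlower : ∀ k, ‖a k‖ ≤ C * Real.exp (p * k))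
    (hupper : ∀ k, ‖a k‖ ≤ C * Real.exp (-(q * k))) (M N : ℕ) :
    ‖∑' k, a k - ∑ k ∈ Finset.Icc (-(M : ℤ)) N, a k‖ ≤
      C * (Real.exp (-(p * M)) / p + Real.exp (-(q * N)) / q) := by
  have hC : 0 ≤ C := by simpa using (norm_nonneg _).trans (hlower 0)
  have htail {c : ℝ} (hc : 0 < c) (m : ℕ) :
      Real.exp (-(c * m)) / (Real.exp c - 1) ≤ Real.exp (-(c * m)) / c := by
    gcongr
    linarith [Real.add_one_le_exp c]
  have hupperSum := hasSum_indicator_Ioi_exp_neg_mul N hq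
  have hlowerSum := (Equiv.neg ℤ).hasSum_iff.mpr (hasSum_indicator_Ioi_exp_neg_mul M hp)
  have hfinite : HasSum ((Finset.Icc (-(M : ℤ)) N : Set ℤ).indicator a)
      (∑ k ∈ Finset.Icc (-(M : ℤ)) N, a k) := by
    rw [← Finset.sum_indicator_subset a subset_rfl]
    exact hasSum_sum_of_ne_finset_zero fun k hk => indicator_of_notMem hk a
  rw [← (ha.hasSum.sub hfinite).tsum_eq]
  refine (tsum_of_norm_bounded ((hlowerSum.add hupperSum).mul_left C) fun k => ?_).trans
    (mul_le_mul_of_nonneg_left (add_le_add (htail hp M) (htail hq N)) hC)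
  simp only [Function.comp_apply, Equiv.neg_apply, indicator_apply, mem_Ioi, Finset.mem_coe,
    Finset.mem_Icc, Int.cast_neg, mul_neg, neg_neg]
  split_ifs with hk hM hN hN hM hN hN
  all_goals try omega
  · simp
  · simpa using hlower k
  · simpa using hupper k

/-- The function `r ↦ r ^ α / (1 + r ^ 2) ^ ((α + β) / 2)`, which is the size of `z E₂(z; α, β)` for
`z > 0`. In both cases it controls the transformed integrand at `ζ`, with `r = exp (Re ζ)`. -/
def decayProfile (α β r : ℝ) : ℝ := r ^ α / (1 + r ^ 2) ^ ((α + β) / 2)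

section decayProfile

variable {α β : ℝ}

theorem decayProfile_exp_pos (x : ℝ) : 0 < decayProfile α β (Real.exp x) := by
  unfold decayProfile
  positivity

theorem decayProfile_exp_le_exp_mul (hα : 0 < α) (hβ : 0 < β) (x : ℝ) :
    decayProfile α β (Real.exp x) ≤ Real.exp (α * x) := by
  have hden : 1 ≤ (1 + Real.exp x ^ 2) ^ ((α + β) / 2) :=
    Real.one_le_rpow (le_add_of_nonneg_right (sq_nonneg _)) (by positivity)
  rw [decayProfile, ← Real.exp_mul, mul_comm x]
  exact div_le_self (Real.exp_pos _).le hden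

theorem decayProfile_exp_le_exp_neg_mul (hα : 0 < α) (hβ : 0 < β) (x : ℝ) :
    decayProfile α β (Real.exp x) ≤ Real.exp (-(β * x)) := by
  have hden : Real.exp ((α + β) * x) ≤ (1 + Real.exp x ^ 2) ^ ((α + β) / 2) := by
    calc Real.exp ((α + β) * x) = (Real.exp x ^ 2) ^ ((α + β) / 2) := by
          rw [← Real.exp_nat_mul, ← Real.exp_mul]
          push_cast
          ring_nf
      _ ≤ _ := by
          gcongr
          exact le_add_of_nonneg_left zero_le_one
  rw [decayProfile, div_le_iff₀ (by positivity)]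
  calc Real.exp x ^ α = Real.exp (-(β * x)) * Real.exp ((α + β) * x) := by
        rw [← Real.exp_mul, ← Real.exp_add]
        ring_nf
    _ ≤ _ := by gcongr

theorem decayProfile_exp_le_exp_neg_min_mul_abs (hα : 0 < α) (hβ : 0 < β) (x : ℝ) :
    decayProfile α β (Real.exp x) ≤ Real.exp (-(min α β * |x|)) := by
  rcases le_total 0 x with hx | hx
  · refine (decayProfile_exp_le_exp_neg_mul hα hβ x).trans (Real.exp_le_exp.mpr ?_)
    rw [abs_of_nonneg hx, neg_le_neg_iff]
    exact mul_le_mul_of_nonneg_right (min_le_right α β) hx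
  · refine (decayProfile_exp_le_exp_mul hα hβ x).trans (Real.exp_le_exp.mpr ?_)
    rw [abs_of_nonpos hx, mul_neg, neg_neg]
    exact mul_le_mul_of_nonpos_right (min_le_left α β) hx

end decayProfile

section meshSize

variable {d α β : ℝ} {n : ℕ}

theorem meshSize_pos (hd : 0 < d) (hμ : 0 < min α β) (hn : 0 < n) : 0 < meshSize d α β n := by
  have : (0 : ℝ) < n := by exact_mod_cast hn
  exact Real.sqrt_pos.mpr (by positivity)

theorem meshSize_sq (hd : 0 ≤ d) (hμ : 0 ≤ min α β) :
    meshSize d α β n ^ 2 = π * d / (min α β * n) :=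
  Real.sq_sqrt (by positivity)

theorem min_mul_mul_meshSize (hd : 0 ≤ d) (hμ : 0 < min α β) (hn : 0 < n) :
    min α β * n * meshSize d α β n = √(π * d * min α β * n) := by
  have : (0 : ℝ) < n := by exact_mod_cast hn
  have hh : 0 ≤ meshSize d α β n := Real.sqrt_nonneg _
  symm
  rw [Real.sqrt_eq_iff_mul_self_eq (by positivity) (by positivity), ← sq, mul_pow,
    meshSize_sq hd hμ.le]
  field_simp

theorem pi_mul_div_meshSize (hd : 0 < d) (hμ : 0 < min α β) (hn : 0 < n) :
    π * d / meshSize d α β n = √(π * d * min α β * n) := by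
  have : (0 : ℝ) < n := by exact_mod_cast hn
  rw [← min_mul_mul_meshSize hd.le hμ hn, div_eq_iff (meshSize_pos hd hμ hn).ne', mul_assoc, ← sq,
    meshSize_sq hd.le hμ.le]
  field_simp

theorem meshSize_div_le (hd : 0 < d) (hμ : 0 < min α β) (hn : 0 < n) :
    meshSize d α β n / d ≤ √(π / (d * min α β)) := by
  have hn' : (1 : ℝ) ≤ n := by exact_mod_cast hn
  refine Real.le_sqrt_of_sq_le ?_
  calc (meshSize d α β n / d) ^ 2 = π / (d * min α β) / n := by
        rw [div_pow, meshSize_sq hd.le hμ.le]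
        field_simp
    _ ≤ _ := div_le_self (by positivity) hn'

theorem min_mul_le_mul_truncM (hα : 0 < α) : min α β * n ≤ α * truncM α β n := by
  unfold truncM
  split_ifs with hmin
  · rw [hmin]
  · rw [(min_choice α β).resolve_left hmin, mul_comm α, ← div_le_iff₀ hα]
    exact Nat.le_ceil _

theorem min_mul_le_mul_truncN (hβ : 0 < β) : min α β * n ≤ β * truncN α β n := by
  unfold truncN
  split_ifs with hmin
  · rw [hmin, mul_comm β, ← div_le_iff₀ hβ]
    exact Nat.le_ceil _
  · rw [(min_choice α β).resolve_left hmin]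

theorem exp_neg_meshSize_div_le {γ : ℝ} {m : ℕ} (hd : 0 < d) (hμ : 0 < min α β) (hn : 0 < n)
    (hγ : min α β ≤ γ) (hm : min α β * n ≤ γ * m) :
    Real.exp (-(γ * meshSize d α β n * m)) / (γ * meshSize d α β n) ≤
      Real.exp (-√(π * d * min α β * n)) / (min α β * meshSize d α β n) := by
  have hh := meshSize_pos hd hμ hn
  rw [← min_mul_mul_meshSize hd.le hμ hn, mul_right_comm γ]
  gcongr

theorem StripDecay.norm_integral_Iic_sub_tsum_sincJ_meshSize_le {g : ℂ → ℂ} {B : ℝ}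
    (hg : StripDecay g d B (min α β)) (hd : 0 < d) (hn : 0 < n) (ξ : ℝ) :
    ‖(∫ x in Iic ξ, g x) -
        ∑' k : ℤ, g (k * meshSize d α β n : ℝ) * (sincJ k (meshSize d α β n) ξ : ℂ)‖ ≤
      2 / min α β * (B / (1 - Real.exp (-(2 * √(π * d * min α β)))) * √(π / (d * min α β))) *
        Real.exp (-√(π * d * min α β * n)) := by
  have hμ := hg.rate_pos
  have hB := hg.bound_nonneg hd
  have : 0 < √(π * d * min α β) := Real.sqrt_pos.mpr (by positivity)
  have hsqrt_le : √(π * d * min α β) ≤ √(π * d * min α β * n) :=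
    Real.sqrt_le_sqrt (le_mul_of_one_le_right (by positivity) (by exact_mod_cast hn))
  have hden : 0 < 1 - Real.exp (-(2 * √(π * d * min α β))) := by
    rw [sub_pos, Real.exp_lt_one_iff, neg_lt_zero]
    positivity
  have hmesh := meshSize_div_le hd hμ hn
  have hbound := hg.norm_integral_Iic_sub_tsum_sincJ_le hd (meshSize_pos hd hμ hn) ξ
  rw [pi_mul_div_meshSize hd hμ hn] at hbound
  calc _ ≤ _ := hbound
    _ = 2 * B / min α β * (meshSize d α β n / d) * (Real.exp (-√(π * d * min α β * n)) /
          (1 - Real.exp (-(2 * √(π * d * min α β * n))))) := by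
        rw [mul_div_mul_comm]
    _ ≤ 2 * B / min α β * √(π / (d * min α β)) * (Real.exp (-√(π * d * min α β * n)) /
          (1 - Real.exp (-(2 * √(π * d * min α β))))) := by
        have hden_le : 1 - Real.exp (-(2 * √(π * d * min α β))) ≤
            1 - Real.exp (-(2 * √(π * d * min α β * n))) := by gcongr
        have := hden.trans_le hden_le
        gcongr
    _ = _ := by ring

theorem norm_tsum_sub_sum_sincJ_meshSize_le {g : ℝ → ℂ} {B : ℝ} (hd : 0 < d) (hα : 0 < α)
    (hβ : 0 < β) (hn : 0 < n) (hg : ∀ x, ‖g x‖ ≤ B * decayProfile α β (Real.exp x)) (ξ : ℝ) :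
    ‖∑' k : ℤ, g (k * meshSize d α β n) * (sincJ k (meshSize d α β n) ξ : ℂ) -
        ∑ k ∈ Finset.Icc (-(truncM α β n : ℤ)) (truncN α β n),
          g (k * meshSize d α β n) * (sincJ k (meshSize d α β n) ξ : ℂ)‖ ≤
      2 / min α β * (1.1 * B) * Real.exp (-√(π * d * min α β * n)) := by
  have hμ := lt_min hα hβ
  have hh := meshSize_pos hd hμ hn
  have hB : 0 ≤ B :=
    nonneg_of_mul_nonneg_left ((norm_nonneg _).trans (hg 0)) (decayProfile_exp_pos 0)
  have hbound {b : ℝ → ℝ} (hb : ∀ x, decayProfile α β (Real.exp x) ≤ b x) (k : ℤ) :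
      ‖g (k * meshSize d α β n) * (sincJ k (meshSize d α β n) ξ : ℂ)‖ ≤
        B * (1.1 * meshSize d α β n) * b (k * meshSize d α β n) := by
    rw [norm_mul, Complex.norm_real, mul_right_comm]
    refine mul_le_mul ((hg _).trans (mul_le_mul_of_nonneg_left (hb _) hB))
      (abs_sincJ_le hh.le k ξ) (norm_nonneg _) ?_
    exact mul_nonneg hB ((decayProfile_exp_pos _).le.trans (hb _))
  have hsum : Summable fun k : ℤ =>
      g (k * meshSize d α β n) * (sincJ k (meshSize d α β n) ξ : ℂ) := by
    refine Summable.of_norm_bounded ((summable_exp_neg_mul_abs_int (mul_pos hμ hh)).mul_left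
        (B * (1.1 * meshSize d α β n)))
      fun k => (hbound (decayProfile_exp_le_exp_neg_min_mul_abs hα hβ) k).trans_eq ?_
    rw [abs_mul, abs_of_pos hh, mul_comm |(k : ℝ)|, ← mul_assoc (min α β)]
  have htrunc := norm_tsum_sub_sum_Icc_le hsum (C := B * (1.1 * meshSize d α β n))
    (mul_pos hα hh) (mul_pos hβ hh)
    (fun k => (hbound (decayProfile_exp_le_exp_mul hα hβ) k).trans_eq (by ring_nf))
    (fun k => (hbound (decayProfile_exp_le_exp_neg_mul hα hβ) k).trans_eq (by ring_nf))
    (truncM α β n) (truncN α β n)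
  refine htrunc.trans ((mul_le_mul_of_nonneg_left (add_le_add
    (exp_neg_meshSize_div_le hd hμ hn (min_le_left α β) (min_mul_le_mul_truncM hα))
    (exp_neg_meshSize_div_le hd hμ hn (min_le_right α β) (min_mul_le_mul_truncN hβ)))
    (by positivity)).trans_eq ?_)
  field_simp
  ring

theorem StripDecay.of_norm_le_decayProfile {g : ℂ → ℂ} {B : ℝ} (hd : 0 < d) (hα : 0 < α)
    (hβ : 0 < β) (hg : DifferentiableOn ℂ g (strip d))
    (hstrip : ∀ ζ ∈ strip d, ‖g ζ‖ ≤ B * decayProfile α β (Real.exp ζ.re)) :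
    StripDecay g d B (min α β) := by
  have hB : 0 ≤ B := nonneg_of_mul_nonneg_left
    ((norm_nonneg _).trans (hstrip _ (ofReal_mem_strip hd 0))) (decayProfile_exp_pos _)
  exact ⟨hg, lt_min hα hβ, fun ζ hζ => (hstrip ζ hζ).trans
    (mul_le_mul_of_nonneg_left (decayProfile_exp_le_exp_neg_min_mul_abs hα hβ ζ.re) hB)⟩

theorem norm_integral_Iic_sub_sum_sincJ_meshSize_le {g : ℂ → ℂ} {B B₀ : ℝ} (hd : 0 < d)
    (hα : 0 < α) (hβ : 0 < β) (hn : 0 < n) (hg : DifferentiableOn ℂ g (strip d))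
    (hstrip : ∀ ζ ∈ strip d, ‖g ζ‖ ≤ B * decayProfile α β (Real.exp ζ.re))
    (hreal : ∀ x : ℝ, ‖g x‖ ≤ B₀ * decayProfile α β (Real.exp x)) (ξ : ℝ) :
    ‖(∫ x in Iic ξ, g x) - ∑ k ∈ Finset.Icc (-(truncM α β n : ℤ)) (truncN α β n),
        g (k * meshSize d α β n : ℝ) * (sincJ k (meshSize d α β n) ξ : ℂ)‖ ≤
      2 / min α β * (B / (1 - Real.exp (-(2 * √(π * d * min α β)))) * √(π / (d * min α β)) +
        1.1 * B₀) * Real.exp (-√(π * d * min α β * n)) := by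
  rw [mul_add, add_mul]
  exact (norm_sub_le_norm_sub_add_norm_sub _ _ _).trans (add_le_add
    ((StripDecay.of_norm_le_decayProfile hd hα hβ hg hstrip
      ).norm_integral_Iic_sub_tsum_sincJ_meshSize_le hd hn ξ)
    (norm_tsum_sub_sum_sincJ_meshSize_le hd hα hβ hn hreal ξ))

end meshSize

/-! ### Change of variables -/

theorem image_Iic_eq_Ioc {p : ℝ → ℝ} (hp : Continuous p) (hmono : StrictMono p) {l : ℝ}
    (hlim : Tendsto p atBot (𝓝 l)) (ξ : ℝ) : p '' Iic ξ = Ioc l (p ξ) := by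
  refine Subset.antisymm ?_ (isPreconnected_Iic.intermediate_value_Ioc self_mem_Iic
    (le_principal_iff.mpr (Iic_mem_atBot ξ)) hp.continuousOn hlim)
  rintro _ ⟨x, hx, rfl⟩
  exact ⟨(hmono.monotone.le_of_tendsto hlim (x - 1)).trans_lt (hmono (sub_one_lt x)),
    hmono.monotone hx⟩

theorem ofReal_re_deriv_eq {ψ : ℂ → ℂ} {p : ℝ → ℝ} (hp : ∀ x : ℝ, ψ x = p x) {x : ℝ}
    (hψ : DifferentiableAt ℂ ψ x) : ((deriv ψ x).re : ℂ) = deriv ψ x := by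
  have hre : HasDerivAt p (deriv ψ x).re x := by
    simpa only [hp, Complex.ofReal_re] using hψ.hasDerivAt.real_of_complex
  have hψ' := hψ.hasDerivAt.comp_ofReal
  simp only [hp] at hψ'
  exact hre.ofReal_comp.unique hψ'

theorem norm_integral_sub_sincIndef_le {ψ f : ℂ → ℂ} {p : ℝ → ℝ} {d α β B B₀ ξ τ : ℝ} {n : ℕ}
    (hd : 0 < d) (hα : 0 < α) (hβ : 0 < β) (hn : 0 < n) (hψ : DifferentiableOn ℂ ψ (strip d))
    (hf : AnalyticOnNhd ℂ f (ψ '' strip d)) (hp : ∀ x : ℝ, ψ x = p x) (hmono : StrictMono p)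
    (hlim : Tendsto p atBot (𝓝 0)) (hξ : ψ ξ = τ)
    (hstrip : ∀ ζ ∈ strip d, ‖f (ψ ζ) * deriv ψ ζ‖ ≤ B * decayProfile α β (Real.exp ζ.re))
    (hreal : ∀ x : ℝ, ‖f (ψ x) * deriv ψ x‖ ≤ B₀ * decayProfile α β (Real.exp x)) :
    IntervalIntegrable (fun t : ℝ => f t) volume 0 τ ∧
    ‖(∫ t in (0 : ℝ)..τ, f t) - sincIndef ψ f d α β n ξ‖ ≤
      2 / min α β * (B / (1 - Real.exp (-(2 * √(π * d * min α β)))) * √(π / (d * min α β)) +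
        1.1 * B₀) * Real.exp (-√(π * d * min α β * n)) := by
  have hξ' : p ξ = τ := by exact_mod_cast (hp ξ).symm.trans hξ
  have hψa := hψ.analyticOnNhd (isOpen_strip d)
  have hdiff (x : ℝ) : DifferentiableAt ℂ ψ x :=
    (hψa _ (ofReal_mem_strip hd x)).differentiableAt
  have hderiv (x : ℝ) : HasDerivAt p (deriv ψ x).re x := by
    simpa only [hp, Complex.ofReal_re] using (hdiff x).hasDerivAt.real_of_complex
  have hg : DifferentiableOn ℂ (fun ζ => f (ψ ζ) * deriv ψ ζ) (strip d) :=
    ((hf.comp hψa (mapsTo_image ψ _)).mul hψa.deriv).differentiableOn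
  have hgi := (StripDecay.of_norm_le_decayProfile hd hα hβ hg hstrip).integrable_ofReal hd
  have hsmul (x : ℝ) : (deriv ψ x).re • f (p x) = f (ψ x) * deriv ψ x := by
    rw [Complex.real_smul, ofReal_re_deriv_eq hp (hdiff x), hp, mul_comm]
  have himage : p '' Iic ξ = Ioc 0 τ :=
    hξ' ▸ image_Iic_eq_Ioc (continuous_iff_continuousAt.mpr fun x => (hderiv x).continuousAt)
      hmono hlim ξ
  have hτ : 0 ≤ τ := hξ' ▸ hmono.monotone.le_of_tendsto hlim ξ
  have hintegral := integral_image_eq_integral_deriv_smul_of_monotoneOn measurableSet_Iic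
    (fun x _ => (hderiv x).hasDerivWithinAt) (hmono.monotone.monotoneOn (Iic ξ))
    fun t : ℝ => f t
  have hintegrable := integrableOn_image_iff_integrableOn_deriv_smul_of_monotoneOn
    measurableSet_Iic (fun x _ => (hderiv x).hasDerivWithinAt) (hmono.monotone.monotoneOn (Iic ξ))
    fun t : ℝ => f t
  simp_rw [hsmul, himage] at hintegral hintegrable
  refine ⟨(intervalIntegrable_iff_integrableOn_Ioc_of_le hτ).mpr
    (hintegrable.mpr hgi.integrableOn), ?_⟩
  rw [intervalIntegral.integral_of_le hτ, hintegral]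
  exact norm_integral_Iic_sub_sum_sincJ_meshSize_le hd hα hβ hn hg hstrip hreal ξ

/-! ### The exponential map -/

/-- The closed sector `|arg w| ≤ arccos c` (for `0 < c ≤ 1`), written without the argument. With
`c = cos d` it contains the image of `strip d` under the exponential. -/
def sector (c : ℝ) : Set ℂ := {w | c * ‖w‖ ≤ w.re}

theorem exp_mem_sector {d : ℝ} (hd : d ≤ π) {ζ : ℂ} (hζ : ζ ∈ strip d) :
    Complex.exp ζ ∈ sector (Real.cos d) := by
  have hcos : Real.cos d ≤ Real.cos ζ.im := by
    rw [← Real.cos_abs ζ.im]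
    exact Real.cos_le_cos_of_nonneg_of_le_pi (abs_nonneg _) hd hζ.le
  rw [sector, mem_ofPred_eq, Complex.norm_exp, Complex.exp_re, mul_comm]
  gcongr

theorem ofReal_mem_sector_one {r : ℝ} (hr : 0 ≤ r) : (r : ℂ) ∈ sector 1 := by
  simp [sector, abs_of_nonneg hr]

theorem mul_one_add_norm_sq_le_of_mem_sector {w : ℂ} {c : ℝ} (hc0 : 0 ≤ c) (hc1 : c ≤ 1)
    (hw : w ∈ sector c) : c * (1 + ‖w‖ ^ 2) ≤ ‖1 + w ^ 2‖ := by
  have hw_sq : ‖w‖ ^ 2 = w.re ^ 2 + w.im ^ 2 := by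
    rw [Complex.sq_norm, Complex.normSq_apply, sq, sq]
  have hnorm : ‖1 + w ^ 2‖ ^ 2 = (1 - ‖w‖ ^ 2) ^ 2 + 4 * w.re ^ 2 := by
    rw [hw_sq, Complex.sq_norm, Complex.normSq_apply]
    simp only [sq, Complex.add_re, Complex.add_im, Complex.one_re, Complex.one_im, Complex.mul_re,
      Complex.mul_im]
    ring
  have hre : (c * ‖w‖) ^ 2 ≤ w.re ^ 2 := pow_le_pow_left₀ (by positivity) hw 2
  have hc_sq : c ^ 2 ≤ 1 := pow_le_one₀ hc0 hc1
  refine le_of_sq_le_sq ?_ (norm_nonneg _)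
  calc (c * (1 + ‖w‖ ^ 2)) ^ 2 = c ^ 2 * (1 - ‖w‖ ^ 2) ^ 2 + 4 * (c * ‖w‖) ^ 2 := by ring
    _ ≤ 1 * (1 - ‖w‖ ^ 2) ^ 2 + 4 * w.re ^ 2 := by gcongr
    _ = _ := by rw [hnorm, one_mul]

theorem norm_mul_le_of_norm_le_mul {a b E : ℂ} {K D : ℝ} (hK : 0 ≤ K) (ha : ‖a‖ ≤ K * ‖E‖)
    (hE : ‖E‖ * ‖b‖ ≤ D) : ‖a * b‖ ≤ K * D := by
  calc ‖a * b‖ ≤ K * ‖E‖ * ‖b‖ := by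
        rw [norm_mul]
        gcongr
    _ ≤ K * D := by
        rw [mul_assoc]
        gcongr

theorem norm_E₂_mul_norm_le {w : ℂ} {c α β : ℝ} (hw0 : w ≠ 0) (hc0 : 0 < c) (hc1 : c ≤ 1)
    (hw : w ∈ sector c) (hαβ : 0 ≤ α + β) :
    ‖E₂ w α β‖ * ‖w‖ ≤ 1 / c ^ ((α + β) / 2) * decayProfile α β ‖w‖ := by
  have hr : 0 < ‖w‖ := norm_pos_iff.mpr hw0
  have hden := mul_one_add_norm_sq_le_of_mem_sector hc0.le hc1 hw
  rw [E₂, norm_div, Complex.norm_cpow_real, Complex.norm_cpow_real, div_mul_eq_mul_div,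
    Real.rpow_sub_one hr.ne', div_mul_cancel₀ _ hr.ne', decayProfile, div_mul_div_comm, one_mul,
    ← Real.mul_rpow hc0.le (by positivity)]
  gcongr

theorem deriv_seMap₂ (ζ : ℂ) : deriv seMap₂ ζ = Complex.exp ζ := (Complex.hasDerivAt_exp ζ).deriv

theorem norm_comp_seMap₂_mul_deriv_le {f : ℂ → ℂ} {K α β c : ℝ} {ζ : ℂ} (hK : 0 ≤ K)
    (hc0 : 0 < c) (hc1 : c ≤ 1) (hζ : Complex.exp ζ ∈ sector c) (hαβ : 0 ≤ α + β)
    (hf : ‖f (seMap₂ ζ)‖ ≤ K * ‖E₂ (seMap₂ ζ) α β‖) :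
    ‖f (seMap₂ ζ) * deriv seMap₂ ζ‖ ≤
      K / c ^ ((α + β) / 2) * decayProfile α β (Real.exp ζ.re) := by
  have hE := norm_E₂_mul_norm_le (Complex.exp_ne_zero ζ) hc0 hc1 hζ hαβ
  rw [deriv_seMap₂, ← Complex.norm_exp, ← mul_one_div K, mul_assoc]
  exact norm_mul_le_of_norm_le_mul hK hf hE

theorem norm_integral_sub_sincIndef_seMap₂_le {f : ℂ → ℂ} {d K α β : ℝ} {n : ℕ}
    (hd : 0 < d) (hd' : d < π / 2) (hK : 0 ≤ K) (hα : 0 < α) (hβ : 0 < β) (hn : 0 < n)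
    (hf : AnalyticOnNhd ℂ f (seMap₂ '' strip d))
    (hb : ∀ z ∈ seMap₂ '' strip d, ‖f z‖ ≤ K * ‖E₂ z α β‖) {τ : ℝ} (hτ : 0 < τ) :
    IntervalIntegrable (fun t : ℝ => f t) volume 0 τ ∧
    ‖(∫ t in (0 : ℝ)..τ, f t) - sincIndef seMap₂ f d α β n (seInv₂ τ)‖ ≤
      constC₂ K d α β * Real.exp (-√(π * d * min α β * n)) := by
  have hcos : 0 < Real.cos d := Real.cos_pos_of_mem_Ioo ⟨by linarith, hd'⟩
  have hαβ := (add_pos hα hβ).le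
  have hstrip (ζ : ℂ) (hζ : ζ ∈ strip d) := norm_comp_seMap₂_mul_deriv_le hK hcos
    (Real.cos_le_one d) (exp_mem_sector (by linarith) hζ) hαβ (hb _ ⟨ζ, hζ, rfl⟩)
  have hreal (x : ℝ) : ‖f (seMap₂ x) * deriv seMap₂ x‖ ≤ K * decayProfile α β (Real.exp x) := by
    have hsector : Complex.exp x ∈ sector 1 := by
      rw [← Complex.ofReal_exp]
      exact ofReal_mem_sector_one (Real.exp_pos x).le
    simpa only [Real.one_rpow, div_one, Complex.ofReal_re] using norm_comp_seMap₂_mul_deriv_le hK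
      one_pos le_rfl hsector hαβ (hb _ ⟨x, ofReal_mem_strip hd x, rfl⟩)
  have herror := norm_integral_sub_sincIndef_le hd hα hβ hn
    Complex.differentiable_exp.differentiableOn hf seMap₂_ofReal Real.exp_strictMono
    Real.tendsto_exp_atBot (seMap₂_seInv₂ hτ) hstrip hreal
  refine ⟨herror.1, herror.2.trans_eq ?_⟩
  rw [constC₂]
  field_simp

/-! ### The inverse hyperbolic sine -/

/-- The principal branch of `√(1 + w²)`, as it occurs in `carcsinh`. -/
def sqrtOneAddSq (w : ℂ) : ℂ := (1 + w ^ 2) ^ (1 / 2 : ℂ)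

section Branch

variable {w : ℂ} {c : ℝ}

theorem sqrtOneAddSq_sq (w : ℂ) : sqrtOneAddSq w ^ 2 = 1 + w ^ 2 := by
  simp [sqrtOneAddSq]

theorem norm_sqrtOneAddSq_sq (w : ℂ) : ‖sqrtOneAddSq w‖ ^ 2 = ‖1 + w ^ 2‖ := by
  rw [← norm_pow, sqrtOneAddSq_sq]

theorem add_sqrtOneAddSq_mul_sub (w : ℂ) : (w + sqrtOneAddSq w) * (sqrtOneAddSq w - w) = 1 := by
  linear_combination sqrtOneAddSq_sq w

theorem exp_carcsinh (w : ℂ) : Complex.exp (carcsinh w) = w + sqrtOneAddSq w :=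
  Complex.exp_log (left_ne_zero_of_mul_eq_one (add_sqrtOneAddSq_mul_sub w))

theorem sinh_carcsinh (w : ℂ) : Complex.sinh (carcsinh w) = w := by
  rw [Complex.sinh, Complex.exp_neg, exp_carcsinh,
    inv_eq_of_mul_eq_one_right (add_sqrtOneAddSq_mul_sub w)]
  ring

theorem one_add_sq_mem_slitPlane (hc : 0 < c) (hw : w ∈ sector c) :
    1 + w ^ 2 ∈ Complex.slitPlane := by
  rw [Complex.mem_slitPlane_iff, sq]
  simp only [Complex.add_re, Complex.add_im, Complex.one_re, Complex.one_im, Complex.mul_re,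
    Complex.mul_im, zero_add]
  rcases eq_or_ne w.im 0 with him | him
  · left
    rw [him, mul_zero, sub_zero]
    exact add_pos_of_pos_of_nonneg one_pos (mul_self_nonneg _)
  · right
    have hnorm : 0 < ‖w‖ := norm_pos_iff.mpr fun h => him (by rw [h, Complex.zero_im])
    have hre : 0 < w.re := (mul_pos hc hnorm).trans_le hw
    rw [mul_comm w.im, ← two_mul]
    exact mul_ne_zero two_ne_zero (mul_ne_zero hre.ne' him)

theorem re_nonneg_of_mem_sector (hc : 0 ≤ c) (hw : w ∈ sector c) : 0 ≤ w.re :=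
  (mul_nonneg hc (norm_nonneg w)).trans hw

theorem sqrtOneAddSq_re_pos (hs : 1 + w ^ 2 ∈ Complex.slitPlane) : 0 < (sqrtOneAddSq w).re := by
  have him : (Complex.log (1 + w ^ 2) * (1 / 2)).im = (1 + w ^ 2).arg / 2 := by
    rw [← Complex.log_im, mul_one_div, Complex.div_ofNat_im]
  rw [sqrtOneAddSq, Complex.cpow_def_of_ne_zero (Complex.slitPlane_ne_zero hs), Complex.exp_re, him]
  have hlower := Complex.neg_pi_lt_arg (1 + w ^ 2)
  have hupper := (Complex.arg_le_pi (1 + w ^ 2)).lt_of_ne (Complex.mem_slitPlane_iff_arg.mp hs).1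
  exact mul_pos (Real.exp_pos _)
    (Real.cos_pos_of_mem_Ioo ⟨by linarith only [hlower], by linarith only [hupper]⟩)

theorem sqrtOneAddSq_ne_zero (hs : 1 + w ^ 2 ∈ Complex.slitPlane) : sqrtOneAddSq w ≠ 0 :=
  fun h => by simpa [h] using sqrtOneAddSq_re_pos hs

theorem hasDerivAt_sqrtOneAddSq (hs : 1 + w ^ 2 ∈ Complex.slitPlane) :
    HasDerivAt sqrtOneAddSq (w / sqrtOneAddSq w) w := by
  have hinner : HasDerivAt (fun w : ℂ => 1 + w ^ 2) (2 * w) w := by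
    simpa using (hasDerivAt_pow 2 w).const_add 1
  refine (hinner.cpow_const (c := (1 / 2 : ℂ)) hs).congr_deriv ?_
  have hS := sqrtOneAddSq_ne_zero hs
  rw [Complex.cpow_sub _ _ (Complex.slitPlane_ne_zero hs), Complex.cpow_one, ← sqrtOneAddSq,
    ← sqrtOneAddSq_sq]
  field_simp

theorem hasDerivAt_carcsinh (hre : 0 ≤ w.re) (hs : 1 + w ^ 2 ∈ Complex.slitPlane) :
    HasDerivAt carcsinh (1 / sqrtOneAddSq w) w := by
  have hpos : 0 < (w + sqrtOneAddSq w).re := add_pos_of_nonneg_of_pos hre (sqrtOneAddSq_re_pos hs)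
  refine (((hasDerivAt_id' w).add (hasDerivAt_sqrtOneAddSq hs)).clog
    (Complex.mem_slitPlane_iff.mpr (Or.inl hpos))).congr_deriv ?_
  have hS := sqrtOneAddSq_ne_zero hs
  have hne := left_ne_zero_of_mul_eq_one (add_sqrtOneAddSq_mul_sub w)
  simp only [Pi.add_apply]
  field_simp
  ring

theorem norm_sq_add_norm_le_norm_exp_carcsinh_sq (hre : 0 ≤ w.re)
    (hs : 1 + w ^ 2 ∈ Complex.slitPlane) :
    ‖w‖ ^ 2 + ‖1 + w ^ 2‖ ≤ ‖Complex.exp (carcsinh w)‖ ^ 2 := by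
  have hS := sqrtOneAddSq_re_pos hs
  have hprod : (sqrtOneAddSq w).re * (sqrtOneAddSq w).im = w.re * w.im := by
    have him := congrArg Complex.im (sqrtOneAddSq_sq w)
    simp only [sq, Complex.add_im, Complex.one_im, Complex.mul_im] at him
    linarith only [him]
  -- `√(1 + w²)` lies in the same closed quadrant as `w`.
  have him : 0 ≤ w.im * (sqrtOneAddSq w).im := by
    refine nonneg_of_mul_nonneg_right (a := (sqrtOneAddSq w).re) ?_ hS
    calc (0 : ℝ) ≤ w.re * w.im ^ 2 := by positivity
      _ = _ := by linear_combination -w.im * hprod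
  have hinner : 0 ≤ (w * (starRingEnd ℂ) (sqrtOneAddSq w)).re := by
    rw [Complex.mul_re, Complex.conj_re, Complex.conj_im, mul_neg, sub_neg_eq_add]
    exact add_nonneg (mul_nonneg hre hS.le) him
  rw [exp_carcsinh, ← norm_sqrtOneAddSq_sq, Complex.sq_norm, Complex.sq_norm, Complex.sq_norm,
    Complex.normSq_add]
  linarith only [hinner]

theorem carcsinh_re_nonneg (hre : 0 ≤ w.re) (hs : 1 + w ^ 2 ∈ Complex.slitPlane) :
    0 ≤ (carcsinh w).re := by
  have hone : 1 ≤ ‖w‖ ^ 2 + ‖1 + w ^ 2‖ := by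
    have htriangle := norm_sub_le (1 + w ^ 2) (w ^ 2)
    rw [add_sub_cancel_right, norm_one, norm_pow] at htriangle
    rwa [add_comm]
  have hexp := hone.trans (norm_sq_add_norm_le_norm_exp_carcsinh_sq hre hs)
  rwa [one_le_sq_iff₀ (norm_nonneg _), Complex.norm_exp, Real.one_le_exp_iff] at hexp

theorem norm_le_norm_one_add_of_re_nonneg {z : ℂ} (hz : 0 ≤ z.re) : ‖z‖ ≤ ‖1 + z‖ := by
  rw [← sq_le_sq₀ (norm_nonneg _) (norm_nonneg _), Complex.sq_norm, Complex.sq_norm,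
    Complex.normSq_add]
  simp only [Complex.normSq_one, one_mul, Complex.conj_re]
  linarith only [hz]

theorem one_le_norm_one_add_of_re_nonneg {z : ℂ} (hz : 0 ≤ z.re) : 1 ≤ ‖1 + z‖ := by
  refine le_trans ?_ (Complex.re_le_norm (1 + z))
  rw [Complex.add_re, Complex.one_re]
  linarith only [hz]

theorem convex_sector (hc : 0 ≤ c) : Convex ℝ (sector c) := by
  intro x hx y hy a b ha hb _
  calc c * ‖a • x + b • y‖ ≤ c * (a * ‖x‖ + b * ‖y‖) := by
        gcongr
        refine (norm_add_le _ _).trans_eq ?_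
        rw [norm_smul_of_nonneg ha, norm_smul_of_nonneg hb]
    _ = a * (c * ‖x‖) + b * (c * ‖y‖) := by ring
    _ ≤ a * x.re + b * y.re := by
        gcongr
        exacts [hx, hy]
    _ = _ := by simp

theorem sqrt_mul_one_add_norm_sq_le_norm_sqrtOneAddSq (hc0 : 0 ≤ c) (hc1 : c ≤ 1)
    (hw : w ∈ sector c) : √(c * (1 + ‖w‖ ^ 2)) ≤ ‖sqrtOneAddSq w‖ := by
  rw [Real.sqrt_le_left (norm_nonneg _), norm_sqrtOneAddSq_sq]
  exact mul_one_add_norm_sq_le_of_mem_sector hc0 hc1 hw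

theorem norm_carcsinh_le (hc0 : 0 < c) (hc1 : c ≤ 1) (hw : w ∈ sector c) :
    ‖carcsinh w‖ ≤ ‖w‖ / √c := by
  have hderiv : ∀ v ∈ sector c, HasDerivWithinAt carcsinh (1 / sqrtOneAddSq v) (sector c) v :=
    fun v hv => (hasDerivAt_carcsinh (re_nonneg_of_mem_sector hc0.le hv)
      (one_add_sq_mem_slitPlane hc0 hv)).hasDerivWithinAt
  have hbound : ∀ v ∈ sector c, ‖1 / sqrtOneAddSq v‖ ≤ 1 / √c := fun v hv => by
    rw [norm_div, norm_one]
    gcongr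
    calc √c ≤ √(c * (1 + ‖v‖ ^ 2)) := by
          gcongr
          exact le_mul_of_one_le_right hc0.le (le_add_of_nonneg_right (sq_nonneg _))
      _ ≤ _ := sqrt_mul_one_add_norm_sq_le_norm_sqrtOneAddSq hc0.le hc1 hv
  have hzero : (0 : ℂ) ∈ sector c := by simp [sector]
  have hmean := (convex_sector hc0.le).norm_image_sub_le_of_norm_hasDerivWithin_le
    hderiv hbound hzero hw
  rwa [show carcsinh 0 = 0 by simp [carcsinh], sub_zero, sub_zero, one_div_mul_eq_div] at hmean

end Branch

theorem abs_sinh_re_le_norm_sinh (z : ℂ) : |Real.sinh z.re| ≤ ‖Complex.sinh z‖ := by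
  rw [Complex.sinh, norm_div, Complex.norm_ofNat, Real.sinh_eq, abs_div, abs_two]
  gcongr
  simpa only [Complex.norm_exp, Complex.neg_re]
    using abs_norm_sub_norm_le (Complex.exp z) (Complex.exp (-z))

theorem norm_cosh_le_cosh_re (z : ℂ) : ‖Complex.cosh z‖ ≤ Real.cosh z.re := by
  rw [Complex.cosh, norm_div, Complex.norm_ofNat, Real.cosh_eq]
  gcongr
  simpa only [Complex.norm_exp, Complex.neg_re] using norm_add_le (Complex.exp z) (Complex.exp (-z))

theorem norm_sinh_le_cosh_re_mul_norm (z : ℂ) : ‖Complex.sinh z‖ ≤ Real.cosh z.re * ‖z‖ := by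
  have hconvex : Convex ℝ (Complex.re ⁻¹' Icc (-|z.re|) |z.re|) :=
    (convex_Icc _ _).linear_preimage Complex.reLm
  have hbound : ∀ v ∈ Complex.re ⁻¹' Icc (-|z.re|) |z.re|, ‖Complex.cosh v‖ ≤ Real.cosh z.re :=
    fun v hv => (norm_cosh_le_cosh_re v).trans (Real.cosh_le_cosh.mpr (abs_le.mpr hv))
  have hmean := hconvex.norm_image_sub_le_of_norm_hasDerivWithin_le (x := 0) (y := z)
    (fun v _ => (Complex.hasDerivAt_sinh v).hasDerivWithinAt) hbound (by simp)
    (abs_le.mp le_rfl)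
  rwa [Complex.sinh_zero, sub_zero, sub_zero] at hmean

theorem norm_sinh_le_sqrt_mul_norm (z : ℂ) :
    ‖Complex.sinh z‖ ≤ √(1 + ‖Complex.sinh z‖ ^ 2) * ‖z‖ := by
  refine (norm_sinh_le_cosh_re_mul_norm z).trans ?_
  gcongr
  refine Real.le_sqrt_of_sq_le ?_
  rw [Real.cosh_sq', ← sq_abs]
  gcongr
  exact abs_sinh_re_le_norm_sinh z

/-! ### Decay of `E₃` along `arcsinh` -/

section Decay

variable {w : ℂ} {c α β T : ℝ}

theorem norm_carcsinh_div_le (hc0 : 0 < c) (hc1 : c ≤ 1) (hw : w ∈ sector c) :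
    ‖carcsinh w / (1 + carcsinh w)‖ ≤ √2 * (‖w‖ / √(c * (1 + ‖w‖ ^ 2))) := by
  have hre := carcsinh_re_nonneg (re_nonneg_of_mem_sector hc0.le hw)
    (one_add_sq_mem_slitPlane hc0 hw)
  rw [norm_div, ← mul_div_assoc, Real.sqrt_mul hc0.le]
  rcases le_total ‖w‖ 1 with hle | hge
  · have hsqrt : √(1 + ‖w‖ ^ 2) ≤ √2 := by
      gcongr
      linarith only [pow_le_one₀ (n := 2) (norm_nonneg w) hle]
    calc ‖carcsinh w‖ / ‖1 + carcsinh w‖ ≤ ‖carcsinh w‖ :=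
          div_le_self (norm_nonneg _) (one_le_norm_one_add_of_re_nonneg hre)
      _ ≤ ‖w‖ / √c := norm_carcsinh_le hc0 hc1 hw
      _ = √(1 + ‖w‖ ^ 2) * ‖w‖ / (√c * √(1 + ‖w‖ ^ 2)) := by field_simp
      _ ≤ _ := by gcongr
  · have hsqrt : √(1 + ‖w‖ ^ 2) ≤ √2 * ‖w‖ := by
      rw [← Real.sqrt_sq (norm_nonneg w), ← Real.sqrt_mul two_pos.le, Real.sq_sqrt (sq_nonneg _)]
      gcongr
      linarith only [one_le_pow₀ (n := 2) hge]
    calc ‖carcsinh w‖ / ‖1 + carcsinh w‖ ≤ 1 :=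
          div_le_one_of_le₀ (norm_le_norm_one_add_of_re_nonneg hre) (norm_nonneg _)
      _ ≤ _ := by
          rw [one_le_div (by positivity)]
          calc √c * √(1 + ‖w‖ ^ 2) ≤ 1 * √(1 + ‖w‖ ^ 2) := by
                gcongr
                exact Real.sqrt_le_one.mpr hc1
            _ ≤ √2 * ‖w‖ := by rwa [one_mul]

theorem le_norm_carcsinh_div (hre : 0 ≤ w.re) (hs : 1 + w ^ 2 ∈ Complex.slitPlane) :
    ‖w‖ / √(1 + ‖w‖ ^ 2) / 2 ≤ ‖carcsinh w / (1 + carcsinh w)‖ := by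
  have hpos := one_pos.trans_le
    (one_le_norm_one_add_of_re_nonneg (carcsinh_re_nonneg hre hs))
  have hsinh := norm_sinh_le_sqrt_mul_norm (carcsinh w)
  rw [sinh_carcsinh] at hsinh
  have hle : ‖w‖ ≤ √(1 + ‖w‖ ^ 2) := Real.le_sqrt_of_sq_le (le_add_of_nonneg_left zero_le_one)
  rw [norm_div, div_div, div_le_div_iff₀ (by positivity) hpos]
  calc ‖w‖ * ‖1 + carcsinh w‖ ≤ ‖w‖ * (1 + ‖carcsinh w‖) := by
        gcongr
        exact (norm_add_le _ _).trans_eq (by rw [norm_one])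
    _ = ‖w‖ + ‖w‖ * ‖carcsinh w‖ := by ring
    _ ≤ √(1 + ‖w‖ ^ 2) * ‖carcsinh w‖ + √(1 + ‖w‖ ^ 2) * ‖carcsinh w‖ := by gcongr
    _ = ‖carcsinh w‖ * (√(1 + ‖w‖ ^ 2) * 2) := by ring

theorem norm_carcsinh_div_rpow_le_of_one_le (hc0 : 0 < c) (hc1 : c ≤ 1) (hw : w ∈ sector c)
    (hα : 1 ≤ α) :
    ‖carcsinh w / (1 + carcsinh w)‖ ^ (α - 1) ≤
      2 ^ ((α - 1) / 2) * (‖w‖ / √(c * (1 + ‖w‖ ^ 2))) ^ (α - 1) := by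
  refine (Real.rpow_le_rpow (norm_nonneg _) (norm_carcsinh_div_le hc0 hc1 hw)
    (sub_nonneg.mpr hα)).trans_eq ?_
  rw [Real.mul_rpow (by positivity) (by positivity), Real.sqrt_eq_rpow 2,
    ← Real.rpow_mul two_pos.le, one_div_mul_eq_div]

theorem norm_carcsinh_div_rpow_le_of_le_one (hc : 0 < c) (hw0 : w ≠ 0) (hw : w ∈ sector c)
    (hα : α ≤ 1) :
    ‖carcsinh w / (1 + carcsinh w)‖ ^ (α - 1) ≤
      (4 / c) ^ ((1 - α) / 2) * (‖w‖ / √(c * (1 + ‖w‖ ^ 2))) ^ (α - 1) := by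
  have : 0 < ‖w‖ := norm_pos_iff.mpr hw0
  have hscale : ‖w‖ / √(1 + ‖w‖ ^ 2) / 2 = (√(4 / c))⁻¹ * (‖w‖ / √(c * (1 + ‖w‖ ^ 2))) := by
    rw [Real.sqrt_mul hc.le, Real.sqrt_div (by positivity), show √4 = (2 : ℝ) by
      rw [show (4 : ℝ) = 2 ^ 2 by norm_num, Real.sqrt_sq two_pos.le]]
    field_simp
  have hlower := le_norm_carcsinh_div (re_nonneg_of_mem_sector hc.le hw)
    (one_add_sq_mem_slitPlane hc hw)
  rw [hscale] at hlower
  refine (Real.rpow_le_rpow_of_nonpos (by positivity) hlower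
    (sub_nonpos.mpr hα)).trans_eq ?_
  rw [Real.mul_rpow (by positivity) (by positivity), Real.inv_rpow (by positivity),
    ← Real.rpow_neg (by positivity), neg_sub, Real.sqrt_eq_rpow (4 / c),
    ← Real.rpow_mul (by positivity), one_div_mul_eq_div]

theorem norm_exp_neg_mul_carcsinh_le (hc0 : 0 < c) (hc1 : c ≤ 1) (hw : w ∈ sector c)
    (hβ : 0 ≤ β) :
    ‖Complex.exp (-(β : ℂ) * carcsinh w)‖ ≤ 1 / (c * (1 + ‖w‖ ^ 2)) ^ (β / 2) := by
  have hexp : c * (1 + ‖w‖ ^ 2) ≤ ‖Complex.exp (carcsinh w)‖ ^ 2 :=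
    (mul_one_add_norm_sq_le_of_mem_sector hc0.le hc1 hw).trans
      ((le_add_of_nonneg_left (sq_nonneg _)).trans (norm_sq_add_norm_le_norm_exp_carcsinh_sq
        (re_nonneg_of_mem_sector hc0.le hw) (one_add_sq_mem_slitPlane hc0 hw)))
  have hpow : ‖Complex.exp (-(β : ℂ) * carcsinh w)‖ =
      1 / (‖Complex.exp (carcsinh w)‖ ^ 2) ^ (β / 2) := by
    rw [Complex.norm_exp, Complex.norm_exp, ← Real.exp_nat_mul, ← Real.exp_mul, one_div,
      ← Real.exp_neg, ← Complex.ofReal_neg, Complex.re_ofReal_mul]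
    congr 1
    push_cast
    ring
  rw [hpow]
  gcongr

theorem norm_E₃_carcsinh_mul_le (hc0 : 0 < c) (hc1 : c ≤ 1) (hw0 : w ≠ 0) (hw : w ∈ sector c)
    (hβ : 0 ≤ β) (hT : 0 ≤ T)
    (hquot : ‖carcsinh w / (1 + carcsinh w)‖ ^ (α - 1) ≤
      T * (‖w‖ / √(c * (1 + ‖w‖ ^ 2))) ^ (α - 1)) :
    ‖E₃ (carcsinh w) α β‖ * ‖w / sqrtOneAddSq w‖ ≤
      T / c ^ ((α + β) / 2) * decayProfile α β ‖w‖ := by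
  have hr : 0 < ‖w‖ := norm_pos_iff.mpr hw0
  have hQ : 0 < c * (1 + ‖w‖ ^ 2) := by positivity
  have hexp := norm_exp_neg_mul_carcsinh_le hc0 hc1 hw hβ
  have hderiv : ‖w / sqrtOneAddSq w‖ ≤ ‖w‖ / √(c * (1 + ‖w‖ ^ 2)) := by
    rw [norm_div]
    gcongr
    exact sqrt_mul_one_add_norm_sq_le_norm_sqrtOneAddSq hc0.le hc1 hw
  rw [E₃, norm_mul, Complex.norm_cpow_real, decayProfile, div_mul_div_comm,
    ← Real.mul_rpow hc0.le (by positivity)]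
  set Q := c * (1 + ‖w‖ ^ 2)
  have hpow : (‖w‖ / √Q) ^ (α - 1) * (‖w‖ / √Q) = ‖w‖ ^ α / Q ^ (α / 2) := by
    rw [← Real.rpow_add_one (by positivity), sub_add_cancel, Real.div_rpow hr.le (by positivity),
      Real.sqrt_eq_rpow Q, ← Real.rpow_mul hQ.le, one_div_mul_eq_div]
  calc _ ≤ T * (‖w‖ / √Q) ^ (α - 1) * (1 / Q ^ (β / 2)) * (‖w‖ / √Q) := by gcongr
    _ = T * ((‖w‖ / √Q) ^ (α - 1) * (‖w‖ / √Q)) * (1 / Q ^ (β / 2)) := by ring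
    _ = T * ‖w‖ ^ α / Q ^ ((α + β) / 2) := by
      rw [hpow, add_div, Real.rpow_add hQ]
      field_simp

end Decay

theorem constc_nonneg {α d : ℝ} (hcos : 0 ≤ Real.cos d) : 0 ≤ constc α d := by
  unfold constc
  split_ifs <;> positivity

theorem norm_carcsinh_div_rpow_le_constc {w : ℂ} {α β d : ℝ} (hcos : 0 < Real.cos d)
    (hα : 0 ≤ α) (hβ : 0 ≤ β) (hw0 : w ≠ 0) (hw : w ∈ sector (Real.cos d)) :
    ‖carcsinh w / (1 + carcsinh w)‖ ^ (α - 1) ≤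
      2 ^ (1 + β / 2) * constc α d * (‖w‖ / √(Real.cos d * (1 + ‖w‖ ^ 2))) ^ (α - 1) := by
  rw [constc]
  split_ifs with hα1
  · refine (norm_carcsinh_div_rpow_le_of_le_one hcos hw0 hw hα1.le).trans ?_
    gcongr
    have hbase : 4 / Real.cos d ≤ 2 * (2 * (1 + 1 / Real.cos d)) := by
      rw [show 2 * (2 * (1 + 1 / Real.cos d)) = 4 + 4 / Real.cos d by ring]
      exact le_add_of_nonneg_left zero_le_four
    calc (4 / Real.cos d) ^ ((1 - α) / 2)
        ≤ (2 * (2 * (1 + 1 / Real.cos d))) ^ ((1 - α) / 2) := by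
          gcongr
      _ = 2 ^ ((1 - α) / 2) * (2 * (1 + 1 / Real.cos d)) ^ ((1 - α) / 2) :=
          Real.mul_rpow two_pos.le (by positivity)
      _ ≤ _ := by
          gcongr
          exacts [one_le_two, by linarith only [hα, hβ]]
  · refine (norm_carcsinh_div_rpow_le_of_one_le hcos (Real.cos_le_one d) hw
      (not_lt.mp hα1)).trans ?_
    gcongr
    exact le_mul_of_one_le_left (by positivity)
      (Real.one_le_rpow one_le_two (by linarith only [hβ]))

theorem div_one_add_le_sinh_div_cosh {z : ℝ} (hz : 0 ≤ z) :
    z / (1 + z) ≤ Real.sinh z / Real.cosh z := by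
  have hexp : (2 * z + 1) * Real.exp (-z) ≤ Real.exp z := by
    calc (2 * z + 1) * Real.exp (-z) ≤ Real.exp (2 * z) * Real.exp (-z) := by
          gcongr
          exact Real.add_one_le_exp _
      _ = Real.exp z := by
          rw [← Real.exp_add]
          ring_nf
  rw [div_le_div_iff₀ (by positivity) (Real.cosh_pos z), Real.sinh_eq, Real.cosh_eq]
  linarith only [hexp]

theorem norm_carcsinh_div_rpow_le_ofReal {r α : ℝ} (hr : 0 < r) :
    ‖carcsinh r / (1 + carcsinh r)‖ ^ (α - 1) ≤
      2 ^ ((1 - α + |1 - α|) / 2) * (‖(r : ℂ)‖ / √(1 * (1 + ‖(r : ℂ)‖ ^ 2))) ^ (α - 1) := by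
  rcases le_total α 1 with hα | hα
  · have hexponent : (4 / 1 : ℝ) ^ ((1 - α) / 2) = 2 ^ ((1 - α + |1 - α|) / 2) := by
      rw [abs_of_nonneg (sub_nonneg.mpr hα), add_self_div_two, div_one,
        show (4 : ℝ) = 2 ^ (2 : ℝ) by norm_num, ← Real.rpow_mul two_pos.le,
        mul_div_cancel₀ _ two_ne_zero]
    rw [← hexponent]
    exact norm_carcsinh_div_rpow_le_of_le_one one_pos (Complex.ofReal_ne_zero.mpr hr.ne')
      (ofReal_mem_sector_one hr.le) hα
  · have harsinh := Real.arsinh_nonneg_iff.mpr hr.le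
    have hquot := div_one_add_le_sinh_div_cosh harsinh
    rw [Real.sinh_arsinh, Real.cosh_arsinh] at hquot
    rw [abs_of_nonpos (sub_nonpos.mpr hα), add_neg_cancel, zero_div, Real.rpow_zero, one_mul,
      one_mul, carcsinh_ofReal, ← Complex.ofReal_one, ← Complex.ofReal_add, ← Complex.ofReal_div,
      Complex.norm_of_nonneg (by positivity), Complex.norm_of_nonneg hr.le]
    gcongr

theorem hasDerivAt_seMap₃ {d : ℝ} (hd : d < π / 2) {ζ : ℂ} (hζ : ζ ∈ strip d) :
    HasDerivAt seMap₃ (Complex.exp ζ / sqrtOneAddSq (Complex.exp ζ)) ζ := by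
  have hd0 : 0 < d := (abs_nonneg _).trans_lt hζ
  have hcos : 0 < Real.cos d := Real.cos_pos_of_mem_Ioo ⟨by linarith, hd⟩
  have hsector := exp_mem_sector (by linarith) hζ
  refine ((hasDerivAt_carcsinh (re_nonneg_of_mem_sector hcos.le hsector)
    (one_add_sq_mem_slitPlane hcos hsector)).comp ζ (Complex.hasDerivAt_exp ζ)).congr_deriv ?_
  rw [one_div_mul_eq_div]

theorem norm_comp_seMap₃_mul_deriv_le {f : ℂ → ℂ} {K α β c d T : ℝ} {ζ : ℂ} (hd : d < π / 2)
    (hζ : ζ ∈ strip d) (hK : 0 ≤ K) (hc0 : 0 < c) (hc1 : c ≤ 1)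
    (hsector : Complex.exp ζ ∈ sector c) (hβ : 0 ≤ β) (hT : 0 ≤ T)
    (hquot : ‖carcsinh (Complex.exp ζ) / (1 + carcsinh (Complex.exp ζ))‖ ^ (α - 1) ≤
      T * (‖Complex.exp ζ‖ / √(c * (1 + ‖Complex.exp ζ‖ ^ 2))) ^ (α - 1))
    (hf : ‖f (seMap₃ ζ)‖ ≤ K * ‖E₃ (seMap₃ ζ) α β‖) :
    ‖f (seMap₃ ζ) * deriv seMap₃ ζ‖ ≤
      K * (T / c ^ ((α + β) / 2)) * decayProfile α β (Real.exp ζ.re) := by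
  have hE := norm_E₃_carcsinh_mul_le hc0 hc1 (Complex.exp_ne_zero ζ) hsector hβ hT hquot
  rw [(hasDerivAt_seMap₃ hd hζ).deriv, ← Complex.norm_exp, mul_assoc]
  exact norm_mul_le_of_norm_le_mul hK hf hE

theorem norm_integral_sub_sincIndef_seMap₃_le {f : ℂ → ℂ} {d K α β : ℝ} {n : ℕ}
    (hd : 0 < d) (hd' : d < π / 2) (hK : 0 ≤ K) (hα : 0 < α) (hβ : 0 < β) (hn : 0 < n)
    (hf : AnalyticOnNhd ℂ f (seMap₃ '' strip d))
    (hb : ∀ z ∈ seMap₃ '' strip d, ‖f z‖ ≤ K * ‖E₃ z α β‖) {τ : ℝ} (hτ : 0 < τ) :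
    IntervalIntegrable (fun t : ℝ => f t) volume 0 τ ∧
    ‖(∫ t in (0 : ℝ)..τ, f t) - sincIndef seMap₃ f d α β n (seInv₃ τ)‖ ≤
      constC₃ K d α β * Real.exp (-√(π * d * min α β * n)) := by
  have hcos : 0 < Real.cos d := Real.cos_pos_of_mem_Ioo ⟨by linarith, hd'⟩
  have hstrip (ζ : ℂ) (hζ : ζ ∈ strip d) := by
    have hsector := exp_mem_sector (by linarith) hζ
    exact norm_comp_seMap₃_mul_deriv_le hd' hζ hK hcos (Real.cos_le_one d) hsector hβ.le
      (mul_nonneg (by positivity) (constc_nonneg hcos.le))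
      (norm_carcsinh_div_rpow_le_constc hcos hα.le hβ.le (Complex.exp_ne_zero ζ) hsector)
      (hb _ ⟨ζ, hζ, rfl⟩)
  have hreal (x : ℝ) : ‖f (seMap₃ x) * deriv seMap₃ x‖ ≤
      K * 2 ^ ((1 - α + |1 - α|) / 2) * decayProfile α β (Real.exp x) := by
    have hsector := ofReal_mem_sector_one (Real.exp_pos x).le
    have hquot := norm_carcsinh_div_rpow_le_ofReal (α := α) (Real.exp_pos x)
    rw [Complex.ofReal_exp] at hsector hquot
    simpa only [Real.one_rpow, div_one, Complex.ofReal_re] using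
      norm_comp_seMap₃_mul_deriv_le hd' (ofReal_mem_strip hd x) hK one_pos le_rfl hsector hβ.le
        (by positivity) hquot (hb _ ⟨x, ofReal_mem_strip hd x, rfl⟩)
  have hmono : StrictMono fun x => Real.arsinh (Real.exp x) :=
    Real.arsinh_strictMono.comp Real.exp_strictMono
  have hlim : Tendsto (fun x => Real.arsinh (Real.exp x)) atBot (𝓝 0) := by
    simpa only [Real.arsinh_zero, Function.comp_def] using
      (Real.continuous_arsinh.tendsto 0).comp Real.tendsto_exp_atBot
  have herror := norm_integral_sub_sincIndef_le hd hα hβ hn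
    (fun ζ hζ => (hasDerivAt_seMap₃ hd' hζ).differentiableAt.differentiableWithinAt) hf
    seMap₃_ofReal hmono hlim (seMap₃_seInv₃ hτ) hstrip hreal
  refine ⟨herror.1, herror.2.trans_eq ?_⟩
  rw [constC₃]
  field_simp

end

theorem theorem3p2 (f : ℂ → ℂ) (d K α β : ℝ) (n : ℕ)
    (hd : 0 < d) (hd' : d < Real.pi / 2) (hK : 0 < K) (hα : 0 < α) (hβ : 0 < β) (hn : 0 < n) :
    ((AnalyticOnNhd ℂ f (seMap₂ '' strip d) →
      (∀ z ∈ seMap₂ '' strip d, ‖f z‖ ≤ K * ‖E₂ z α β‖) →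
      ∀ τ ∈ Set.Ioi (0 : ℝ),
        IntervalIntegrable (fun t : ℝ => f (t : ℂ)) volume 0 τ ∧
        ‖(∫ t in (0 : ℝ)..τ, f (t : ℂ)) - sincIndef seMap₂ f d α β n (seInv₂ τ)‖ ≤
          constC₂ K d α β * Real.exp (-Real.sqrt (Real.pi * d * min α β * n)))) ∧
    ((AnalyticOnNhd ℂ f (seMap₃ '' strip d) →
      (∀ z ∈ seMap₃ '' strip d, ‖f z‖ ≤ K * ‖E₃ z α β‖) →
      ∀ τ ∈ Set.Ioi (0 : ℝ),
        IntervalIntegrable (fun t : ℝ => f (t : ℂ)) volume 0 τ ∧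
        ‖(∫ t in (0 : ℝ)..τ, f (t : ℂ)) - sincIndef seMap₃ f d α β n (seInv₃ τ)‖ ≤
          constC₃ K d α β * Real.exp (-Real.sqrt (Real.pi * d * min α β * n)))) :=
  ⟨fun hf hb _ hτ => norm_integral_sub_sincIndef_seMap₂_le hd hd' hK.le hα hβ hn hf hb hτ,
    fun hf hb _ hτ => norm_integral_sub_sincIndef_seMap₃_le hd hd' hK.le hα hβ hn hf hb hτ⟩
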